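/- Let $n\ge 1$ and let $\mathbb I_1,\dots,\mathbb I_n$ be independent Bernoulli random variables with $P(\mathbb I_i=1)=p_i=1-P(\mathbb I_i=0)$. Put $q_i=1-p_i$, $W=\sum_{i=1}^n\mathbb I_i$, $W^{(i)}=W-\mathbb I_i$, and $$\widehat\lambda=\sum_{i=1}^n p_i,\qquad \sigma^2=\sum_{i=1}^n p_iq_i,\qquad \tau=\max_i p_iq_i,$$ $$M=\Big\lfloor \frac{(\sum_i p_i^2)^3}{(\sum_i p_i^3)^{2}}\Big\rfloor,\qquad \delta=\frac{(\sum_i p_i^2)^3}{(\sum_i p_i^3)^{2}}-M,\qquad p=\frac{\sum_i p_i^3}{\sum_i p_i^2},\qquad \alpha=\widehat\lambda-Mp,$$ $$\theta_1=\frac{Mp^2}{(1-2p)^2(Mp+\alpha)} .$$ These quantities always satisfy $\alpha\ge 0$ and $0\le p\le 1$ when the $p_i$ are not all zero. Let $\mathrm{BCP}$ be the law of $Y_1+Y_2$, where $Y_1$ is Poisson with mean $\alpha$ (degenerate at $0$ if $\alpha=0$), $Y_2$ is binomial with parameters $M$ and $p$, and $Y_1,Y_2$ are independent. For laws on $\mathbb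 Z_+$ let $\|\mathcal L(Y)-\mathcal L(Z)\|_{TV}=\sum_{j\ge 0}|P(Y=j)-P(Z=j)|$. With $\Delta f(k)=f(k+1)-f(k)$, let $$d=\sum_{k\in\mathbb Z}|\Delta^2P(W=k)|,\qquad d_1=\max_{1\le i\le n}\ \sum_{k\in\mathbb Z}|\Delta^2P(W^{(i)}=k)| .$$ Assume $\sigma^2>3\tau$. Then $$d\le\frac{2}{\sigma\sqrt{\sigma^2-\tau}},\qquad d_1\le\frac{2}{\sqrt{(\sigma^2-\tau)(\sigma^2-3\tau)}},$$ and, if moreover $\max(p,\theta_1)<1/2$, then $$\|\mathcal L(W)-\mathrm{BCP}\|_{TV}\le B:=\frac{2}{(1-2\theta_1)\widehat\lambda}\left\{\frac{2\sum_{i=1}^n p_i^4}{\sqrt{(\sigma^2-\tau)(\sigma^2-3\tau)}}+\frac{2Mp^4}{(1-2p)^2\sigma\sqrt{\sigma^2-\tau}}+(1+2p)\delta p^2\right\}.$$ For success probabilities of constant order the bound is $O(n^{-1})$: for all real $a>0$ and $\rho<1/2$ there are constants $K$ and $N$, depending only on $a$ and $\rho$, such that for all $n\ge N$ and all $p_1,\dots,p_n\in[a,1]$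 with $\max(p,\theta_1)\le\rho$ one has $\sigma^2>3\tau$ and $\|\mathcal L(W)-\mathrm{BCP}\|_{TV}\le B\le K/n$. -/

import Mathlib

open MeasureTheory ProbabilityTheory

namespace BCP

noncomputable section

/-- The total variation norm `∑ j, |P(Y = j) - P(Z = j)|` of the difference of two laws on `ℕ`
(twice the total variation metric). -/
def tvNorm (μ ν : Measure ℕ) : ℝ := ∑' j : ℕ, |μ.real {j} - ν.real {j}|

/-- The point mass `P(Y = k)` at an integer `k` of a law on `ℕ`; it vanishes for `k < 0`. -/
def pmfInt (ν : Measure ℕ) (k : ℤ) : ℝ := ν.real {j : ℕ | (j : ℤ) = k}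

/-- The total variation norm of `ν * (I₁ - I) * (I₁ - I)`, where `I₁` and `I` are the unit masses
at `1` and `0`: the sum over all integers `k` of `|Δ² P(Y = k)|` with `Y` of law `ν` and
`Δ f k = f (k + 1) - f k`. -/
def secondDiffNorm (ν : Measure ℕ) : ℝ :=
  ∑' k : ℤ, |pmfInt ν (k + 2) - 2 * pmfInt ν (k + 1) + pmfInt ν k|

/-- `X 0, …, X (n - 1)` are independent Bernoulli random variables with
`P(X i = 1) = p i = 1 - P(X i = 0)`. -/
structure IsIndepBernoulli {Ω : Type*} [MeasurableSpace Ω] (P : Measure Ω) {n : ℕ}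
    (X : Fin n → Ω → ℕ) (p : Fin n → ℝ) : Prop where
  measurable : ∀ i, Measurable (X i)
  indep : iIndepFun X P
  prob_one : ∀ i, P.real {ω | X i ω = 1} = p i
  prob_zero : ∀ i, P.real {ω | X i ω = 0} = 1 - p i

/-- The law of `W = ∑ i, X i`. -/
def lawSum {Ω : Type*} [MeasurableSpace Ω] (P : Measure Ω) {n : ℕ} (X : Fin n → Ω → ℕ) :
    Measure ℕ := P.map (fun ω => ∑ j, X j ω)

/-- The law of `W⁽ⁱ⁾ = W - X i`. -/
def lawSumErase {Ω : Type*} [MeasurableSpace Ω] (P : Measure Ω) {n : ℕ} (X : Fin n → Ω → ℕ)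
    (i : Fin n) : Measure ℕ := P.map (fun ω => ∑ j ∈ Finset.univ.erase i, X j ω)

/-- `d`, the norm of `ℒ(W) * (I₁ - I)^{*2}`. -/
def d {Ω : Type*} [MeasurableSpace Ω] (P : Measure Ω) {n : ℕ} (X : Fin n → Ω → ℕ) : ℝ :=
  secondDiffNorm (lawSum P X)

/-- `d₁`, the maximum over `i` of the norm of `ℒ(W⁽ⁱ⁾) * (I₁ - I)^{*2}`. -/
def d₁ {Ω : Type*} [MeasurableSpace Ω] (P : Measure Ω) {n : ℕ} (X : Fin n → Ω → ℕ) : ℝ :=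
  ⨆ i : Fin n, secondDiffNorm (lawSumErase P X i)

section Parameters

variable {n : ℕ} (p : Fin n → ℝ)

/-- The real number `(∑ pᵢ²)³ (∑ pᵢ³)⁻²`, whose integer part is `M`. -/
def realM : ℝ := (∑ i, p i ^ 2) ^ 3 / (∑ i, p i ^ 3) ^ 2

/-- The number of trials of the binomial component. -/
def M : ℕ := ⌊realM p⌋₊

/-- The fractional part `δ`. -/
def δ : ℝ := realM p - M p

/-- The success probability `p = ∑ pᵢ³ / ∑ pᵢ²` of the binomial component. -/
def prob : ℝ := (∑ i, p i ^ 3) / ∑ i, p i ^ 2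

/-- `λ̂ = ∑ pᵢ`. -/
def lam : ℝ := ∑ i, p i

/-- The mean `α = ∑ pᵢ - M p` of the Poisson component. -/
def α : ℝ := lam p - M p * prob p

/-- `σ² = ∑ pᵢ qᵢ`. -/
def sigmaSq : ℝ := ∑ i, p i * (1 - p i)

/-- `σ`. -/
def σ : ℝ := √(sigmaSq p)

/-- `τ = maxᵢ pᵢ qᵢ`. -/
def τ : ℝ := ⨆ i : Fin n, p i * (1 - p i)

/-- `θ₁ = M p² / ((1 - 2p)² (M p + α))`. -/
def θ₁ : ℝ :=
  M p * prob p ^ 2 / ((1 - 2 * prob p) ^ 2 * (M p * prob p + α p))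

/-- The binomial success probability lies in `[0, 1]`. -/
theorem prob_mem_Icc (hp : ∀ i, p i ∈ Set.Icc (0 : ℝ) 1) : prob p ∈ Set.Icc (0 : ℝ) 1 := by
  have h3 : 0 ≤ ∑ i, p i ^ 3 := Finset.sum_nonneg fun i _ => pow_nonneg (hp i).1 3
  have h2 : 0 ≤ ∑ i, p i ^ 2 := Finset.sum_nonneg fun i _ => pow_nonneg (hp i).1 2
  refine ⟨div_nonneg h3 h2, div_le_one_of_le₀ ?_ h2⟩
  exact Finset.sum_le_sum fun i _ => pow_le_pow_of_le_one (hp i).1 (hp i).2 (by norm_num)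

/-- The Poisson mean is nonnegative, so that the approximating law is a genuine distribution. -/
theorem α_nonneg (hp : ∀ i, 0 ≤ p i) : 0 ≤ α p := by
  have h1 : 0 ≤ ∑ i, p i := Finset.sum_nonneg fun i _ => hp i
  have h2 : 0 ≤ ∑ i, p i ^ 2 := Finset.sum_nonneg fun i _ => pow_nonneg (hp i) 2
  have h3 : 0 ≤ ∑ i, p i ^ 3 := Finset.sum_nonneg fun i _ => pow_nonneg (hp i) 3
  have hcs : (∑ i, p i ^ 2) ^ 2 ≤ (∑ i, p i) * ∑ i, p i ^ 3 :=
    Finset.sum_sq_le_sum_mul_sum_of_sq_le_mul _ (fun i _ => hp i)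
      (fun i _ => pow_nonneg (hp i) 3) (fun i _ => le_of_eq (by ring))
  have hM : (M p : ℝ) ≤ realM p := Nat.floor_le (by unfold realM; positivity)
  have hpr : 0 ≤ prob p := div_nonneg h3 h2
  have key : realM p * prob p ≤ ∑ i, p i := by
    unfold realM prob
    rcases h3.eq_or_lt with h | h
    · simpa [← h] using h1
    rcases h2.eq_or_lt with h' | h'
    · simpa [← h'] using h1
    calc (∑ i, p i ^ 2) ^ 3 / (∑ i, p i ^ 3) ^ 2 * ((∑ i, p i ^ 3) / ∑ i, p i ^ 2)
        = (∑ i, p i ^ 2) ^ 2 / ∑ i, p i ^ 3 := by field_simp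
      _ ≤ ∑ i, p i := by rw [div_le_iff₀ h]; exact hcs
  have := mul_le_mul_of_nonneg_right hM hpr
  unfold α lam
  linarith

/-- The law of `Y₁ + Y₂` with `Y₁` Poisson of mean `a`, `Y₂` binomial with parameters `m` and `r`,
and `Y₁`, `Y₂` independent. -/
def poissonBinomial (a : NNReal) (m : ℕ) (r : unitInterval) : Measure ℕ :=
  (poissonMeasure a).conv (binomial m r)

/-- The approximating law, with the parameters `α`, `M` and `p` above. By `α_nonneg` and
`prob_mem_Icc` the coercions of `α` to `[0, ∞)` and of `p` to `[0, 1]` do not change them. -/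
def bcp : Measure ℕ :=
  poissonBinomial (α p).toNNReal (M p) (Set.projIcc 0 1 zero_le_one (prob p))

/-- The explicit bound on the approximation error. -/
def errorBound : ℝ :=
  2 / ((1 - 2 * θ₁ p) * lam p) *
    (2 * (∑ i, p i ^ 4) / √((σ p ^ 2 - τ p) * (σ p ^ 2 - 3 * τ p))
      + 2 * M p * prob p ^ 4 / ((1 - 2 * prob p) ^ 2 * σ p * √(σ p ^ 2 - τ p))
      + (1 + 2 * prob p) * δ p * prob p ^ 2)

end Parameters

end

end BCP

/-!
Write `w = X - 1` and `‖·‖` for the `ℓ¹` norm of the coefficients of a power series. Let `F` be the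
generating function of `W`, `Fᵢ` that of `W⁽ⁱ⁾`, and `G` that of the approximating law. All norms in
the statement are norms of power series: `d = ‖w² F‖`, `d₁ = maxᵢ ‖w² Fᵢ‖`, and the total variation
norm is `‖F - G‖`.

*Smoothness.* The coefficients of a product of linear factors `1 + pᵢ w` are log-concave, hence
unimodal, so `‖w F‖` is twice the largest coefficient. Fourier inversion and
`|1 + pᵢ (e^{it} - 1)| ≤ exp (-pᵢ qᵢ (1 - cos t))` bound that coefficient by `e^{-V} I₀(V)`, where `V`
is the variance, and expanding the Bessel function gives `e^{-V} I₀(V) ≤ 1 / (2 √V)`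
(`integral_exp_mul_cos_le`). So `‖w F‖ ≤ 1 / √V` (`l1_X_sub_one_mul_bernoulliPoly_le`). Splitting the
variables into two groups whose variances differ by at most `τ` and multiplying the two first-order
bounds yields the bound for second differences (`l1_X_sub_one_sq_mul_bernoulliPoly_le`).

*Stein's method.* If `D` has total mass `0` and `D' - λ D = w S`, then `‖D‖ ≤ (2 / λ) ‖S‖`
(`l1_le_of_derivative_sub_eq`): the equation with `S = X ^ k` has an explicit solution, which is
nonnegative off `k + 1`, and the general solution is a superposition of these. This is the Poisson
Stein factor in dual form. Both `F` and `G` have explicit logarithmic derivatives: the expansion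
`F' = (∑ pᵢ - ∑ pᵢ² w + ∑ pᵢ³ w²) F - w³ ∑ pᵢ⁴ Fᵢ` is to be compared with `(1 + p w)⁻¹` expanded to
the same order. The choice of `M`, `p`, `α` matches the three power sums up to `δ`, so `D = F - G`
solves such an equation with `λ = λ̂`, where `S` consists of `F` and `w F` with small coefficients
from `δ`, of `∑ pᵢ⁴ w² Fᵢ`, of `M p⁴ (1 + p w)⁻¹ w² F`, and of the feedback term
`-M p² (1 + p w)⁻¹ D`. As `‖(1 + p w)⁻¹‖ ≤ 1 / (1 - 2 p)`, the feedback term contributes at most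
`2 θ₁ ‖D‖`, and `θ₁ < 1 / 2` allows it to be absorbed (`toReal_l1_bernoulliPoly_sub_le`,
`IsIndepBernoulli.tvNorm_le`).

*Rate.* `p ≤ ρ < 1 / 2` says `∑ pᵢ³ ≤ ρ ∑ pᵢ²`, so `σ² ≥ ∑ pᵢ² (1 - pᵢ)` is of order `n`, as is `λ̂`,
while the three terms of the error bound have numerators at most of order `n`.
-/

namespace BCP

section

open PowerSeries
open scoped ENNReal

/-! ### The `ℓ¹` norm of a power series -/

/-- The `ℓ¹` norm `∑ n, |fₙ|` of the coefficients of a real power series, with values in `[0, ∞]`.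
On the generating functions of two laws on `ℕ`, the norm of the difference is their total variation
norm; multiplication of power series is convolution. -/
noncomputable def l1 (F : PowerSeries ℝ) : ℝ≥0∞ := ∑' n, ‖coeff n F‖ₑ

theorem l1_add_le (F G : PowerSeries ℝ) : l1 (F + G) ≤ l1 F + l1 G := by
  unfold l1
  rw [← ENNReal.tsum_add]
  exact ENNReal.tsum_le_tsum fun n => by rw [map_add]; exact enorm_add_le _ _

theorem l1_neg (F : PowerSeries ℝ) : l1 (-F) = l1 F := by
  simp [l1]

theorem l1_sub_le (F G : PowerSeries ℝ) : l1 (F - G) ≤ l1 F + l1 G := by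
  rw [sub_eq_add_neg, ← l1_neg G]
  exact l1_add_le _ _

theorem l1_mul_le (F G : PowerSeries ℝ) : l1 (F * G) ≤ l1 F * l1 G := by
  calc l1 (F * G) ≤ ∑' n, ∑ x ∈ Finset.HasAntidiagonal.antidiagonal n, ‖coeff x.1 F‖ₑ * ‖coeff x.2 G‖ₑ := by
        refine ENNReal.tsum_le_tsum fun n => ?_
        rw [coeff_mul]
        refine (enorm_sum_le _ _).trans (Finset.sum_le_sum fun x _ => ?_)
        rw [enorm_mul]
    _ = ∑' x : ℕ × ℕ, ‖coeff x.1 F‖ₑ * ‖coeff x.2 G‖ₑ := by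
        rw [← Finset.HasAntidiagonal.sigmaAntidiagonalEquivProd.tsum_eq, ENNReal.tsum_sigma']
        refine tsum_congr fun n => ?_
        rw [tsum_fintype, ← Finset.sum_coe_sort]
        rfl
    _ = l1 F * l1 G := by
        rw [ENNReal.tsum_prod']
        simp only [ENNReal.tsum_mul_left, ENNReal.tsum_mul_right, l1]

theorem l1_C_mul (a : ℝ) (F : PowerSeries ℝ) : l1 (C a * F) = ‖a‖ₑ * l1 F := by
  simp [l1, enorm_mul, ENNReal.tsum_mul_left]

theorem l1_X_mul (F : PowerSeries ℝ) : l1 (X * F) = l1 F := by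
  unfold l1
  rw [tsum_eq_zero_add' ENNReal.summable]
  simp [coeff_succ_X_mul]

theorem l1_X_sub_one_mul_le (F : PowerSeries ℝ) : l1 ((X - 1) * F) ≤ 2 * l1 F := by
  rw [sub_mul, one_mul, two_mul]
  exact (l1_sub_le _ _).trans (by rw [l1_X_mul])

theorem l1_sum_le {ι : Type*} (s : Finset ι) (F : ι → PowerSeries ℝ) :
    l1 (∑ i ∈ s, F i) ≤ ∑ i ∈ s, l1 (F i) := by
  classical
  induction s using Finset.induction_on with
  | empty => simp [l1]
  | insert i s hi ih =>
    rw [Finset.sum_insert hi, Finset.sum_insert hi]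
    exact (l1_add_le _ _).trans (by gcongr)

/-- If the absolute values of the coefficients are dominated by a summable real sequence, the
`ℓ¹` norm is at most its sum. -/
theorem l1_le_ofReal {F : PowerSeries ℝ} {u : ℕ → ℝ} {a : ℝ} (hu : HasSum u a)
    (h : ∀ n, |coeff n F| ≤ u n) : l1 F ≤ ENNReal.ofReal a := by
  have h0 : ∀ n, 0 ≤ u n := fun n => (abs_nonneg _).trans (h n)
  rw [← hu.tsum_eq, ENNReal.ofReal_tsum_of_nonneg h0 hu.summable]
  refine ENNReal.tsum_le_tsum fun n => ?_
  rw [Real.enorm_eq_ofReal_abs]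
  exact ENNReal.ofReal_le_ofReal (h n)

theorem toReal_l1 (F : PowerSeries ℝ) : (l1 F).toReal = ∑' n, |coeff n F| := by
  unfold l1
  rw [ENNReal.tsum_toReal_eq fun n => by simp]
  simp

end

section

open PowerSeries
open scoped ENNReal

/-! ### The Stein factor of the Poisson law -/

/-- The point probabilities of the Poisson law of mean `l`. -/
noncomputable def poissonProb (l : ℝ) (j : ℕ) : ℝ := Real.exp (-l) * (l ^ j / j.factorial)

theorem poissonProb_pos {l : ℝ} (hl : 0 < l) (j : ℕ) : 0 < poissonProb l j := by
  unfold poissonProb; positivity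

theorem hasSum_poissonProb (l : ℝ) : HasSum (poissonProb l) 1 := by
  have h := (NormedSpace.expSeries_div_hasSum_exp l).mul_left (Real.exp (-l))
  rw [← Real.exp_eq_exp_ℝ, ← Real.exp_add, neg_add_cancel, Real.exp_zero] at h
  exact h

theorem succ_mul_poissonProb_succ (l : ℝ) (j : ℕ) :
    (j + 1) * poissonProb l (j + 1) = l * poissonProb l j := by
  unfold poissonProb
  rw [Nat.factorial_succ]
  push_cast
  field_simp
  ring

/-- `P(Y ≥ k + 2)` for `Y` Poisson of mean `l`. -/
noncomputable def poissonTail (l : ℝ) (k : ℕ) : ℝ :=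
  1 - ∑ j ∈ Finset.range (k + 2), poissonProb l j

/-- The jump of the Poisson density factor of `poissonKernel l k` across `k + 1`. -/
noncomputable def kernelJump (l : ℝ) (k : ℕ) : ℝ :=
  (k + 1 - l) / ((k + 1) * (l * poissonProb l (k + 1)))

/-- The Poisson density factor of `poissonKernel l k` below `k + 1`. -/
noncomputable def kernelFactor (l : ℝ) (k : ℕ) : ℝ :=
  1 / (k + 1) - kernelJump l k * poissonTail l k

/-- The Green kernel of the Poisson Stein equation: the sequence `D` of total mass `0` solving
`(j + 1) D (j + 1) - l D j = 1{j = k + 1} - 1{j = k}`. It is a multiple of the Poisson law up to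
`k`, another multiple of it from `k + 2` on, and it takes its only negative value at `k + 1`. -/
noncomputable def poissonKernel (l : ℝ) (k j : ℕ) : ℝ :=
  kernelFactor l k * poissonProb l j
    + kernelJump l k * (if k + 2 ≤ j then poissonProb l j else 0)
    - if j = k + 1 then 1 / (k + 1 : ℝ) else 0

theorem hasSum_poissonTail (l : ℝ) (k : ℕ) :
    HasSum (fun j => poissonProb l (j + (k + 2))) (poissonTail l k) :=
  (hasSum_nat_add_iff' (k + 2)).2 (hasSum_poissonProb l)

theorem hasSum_poissonKernel (l : ℝ) (k : ℕ) : HasSum (poissonKernel l k) 0 := by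
  have h2 : HasSum (fun j => if k + 2 ≤ j then poissonProb l j else 0) (poissonTail l k) := by
    rw [← hasSum_nat_add_iff' (k + 2), Finset.sum_eq_zero, sub_zero]
    · simpa using hasSum_poissonTail l k
    · intro i hi
      rw [if_neg (by simpa using hi)]
  have h3 : HasSum (fun j => if j = k + 1 then 1 / (k + 1 : ℝ) else 0) (1 / (k + 1 : ℝ)) :=
    hasSum_ite_eq _ _
  convert! (((hasSum_poissonProb l).mul_left (kernelFactor l k)).add
    (h2.mul_left (kernelJump l k))).sub h3 using 1
  unfold kernelFactor
  ring

theorem poissonKernel_rec {l : ℝ} (hl : 0 < l) (k j : ℕ) :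
    (j + 1) * poissonKernel l k (j + 1) - l * poissonKernel l k j =
      (if j = k + 1 then 1 else 0) - if j = k then 1 else 0 := by
  have hj := succ_mul_poissonProb_succ l j
  unfold poissonKernel
  rcases lt_trichotomy j k with h | rfl | h
  · rw [if_neg (by omega), if_neg (by omega), if_neg (by omega), if_neg (by omega),
      if_neg (by omega), if_neg (by omega)]
    linear_combination kernelFactor l k * hj
  · rw [if_neg (by omega), if_pos rfl, if_neg (by omega), if_neg (by omega),
      if_neg (by omega), if_pos rfl]
    have : (j + 1 : ℝ) * (1 / (j + 1)) = 1 := by field_simp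
    linear_combination kernelFactor l j * hj - this
  rcases eq_or_ne j (k + 1) with rfl | h'
  · rw [if_pos (by omega), if_neg (by omega), if_neg (by omega), if_pos rfl, if_pos rfl,
      if_neg (by omega)]
    have hp := (poissonProb_pos hl (k + 1)).ne'
    have : kernelJump l k * (l * poissonProb l (k + 1)) = 1 - l / (k + 1) := by
      unfold kernelJump
      have := hl.ne'
      field_simp
    linear_combination (kernelFactor l k + kernelJump l k) * hj + this
  · rw [if_pos (by omega), if_neg (by omega), if_pos (by omega), if_neg (by omega),
      if_neg (by omega), if_neg (by omega)]
    linear_combination (kernelFactor l k + kernelJump l k) * hj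

theorem kernelFactor_nonneg {l : ℝ} (hl : 0 < l) (k : ℕ) : 0 ≤ kernelFactor l k := by
  have hp := poissonProb_pos hl (k + 1)
  have h1 : HasSum (fun j => poissonProb l (j + (k + 1)))
      (poissonTail l k + poissonProb l (k + 1)) := by
    have := (hasSum_nat_add_iff' (k + 1)).2 (hasSum_poissonProb l)
    convert! this using 1
    rw [poissonTail, Finset.sum_range_succ]
    ring
  -- `l P(Y ≥ k + 1) = E[Y; Y ≥ k + 2]` for `Y` Poisson of mean `l`
  have key : (k + 1) * poissonTail l k ≤ l * (poissonTail l k + poissonProb l (k + 1)) := by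
    refine hasSum_le (fun j => ?_) ((hasSum_poissonTail l k).mul_left (k + 1 : ℝ)) (h1.mul_left l)
    have := succ_mul_poissonProb_succ l (j + (k + 1))
    rw [← this, show j + (k + 1) + 1 = j + (k + 2) by ring]
    have := poissonProb_pos hl (j + (k + 2))
    push_cast
    gcongr
    linarith [(Nat.cast_nonneg j : (0 : ℝ) ≤ j)]
  have : kernelJump l k * poissonTail l k
      = ((k + 1 - l) * poissonTail l k) / ((k + 1) * (l * poissonProb l (k + 1))) := by
    unfold kernelJump; ring
  rw [kernelFactor, this, sub_nonneg, div_le_div_iff₀ (by positivity) (by positivity)]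
  nlinarith [(Nat.cast_nonneg k : (0 : ℝ) ≤ k)]

theorem kernelFactor_add_kernelJump_nonneg {l : ℝ} (hl : 0 < l) (k : ℕ) :
    0 ≤ kernelFactor l k + kernelJump l k := by
  have hp := poissonProb_pos hl (k + 1)
  have hk : (0 : ℝ) ≤ k := k.cast_nonneg
  -- `l P(Y ≤ k) = E[Y; Y ≤ k + 1]` for `Y` Poisson of mean `l`
  have key : l * ((1 - poissonTail l k) - poissonProb l (k + 1))
      ≤ (k + 1) * (1 - poissonTail l k) := by
    have h0 : 1 - poissonTail l k = ∑ j ∈ Finset.range (k + 2), poissonProb l j := by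
      rw [poissonTail]; ring
    have h1 : (1 - poissonTail l k) - poissonProb l (k + 1)
        = ∑ j ∈ Finset.range (k + 1), poissonProb l j := by
      rw [h0, Finset.sum_range_succ]; ring
    rw [h1, h0, Finset.mul_sum, Finset.sum_range_succ' (n := k + 1), mul_add, Finset.mul_sum]
    have : ∑ i ∈ Finset.range (k + 1), l * poissonProb l i
        ≤ ∑ i ∈ Finset.range (k + 1), (k + 1) * poissonProb l (i + 1) := by
      refine Finset.sum_le_sum fun j hj => ?_
      rw [← succ_mul_poissonProb_succ l j]
      have := poissonProb_pos hl (j + 1)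
      gcongr
      exact Nat.lt_succ_iff.1 (Finset.mem_range.1 hj)
    have := poissonProb_pos hl 0
    nlinarith
  have : kernelFactor l k + kernelJump l k
      = 1 / (k + 1) + ((k + 1 - l) * (1 - poissonTail l k))
        / ((k + 1) * (l * poissonProb l (k + 1))) := by
    unfold kernelFactor kernelJump; ring
  rw [this, div_add_div _ _ (by positivity) (by positivity)]
  apply div_nonneg _ (by positivity)
  nlinarith

theorem abs_poissonKernel_le {l : ℝ} (hl : 0 < l) (k j : ℕ) :
    |poissonKernel l k j| ≤ poissonKernel l k j + if j = k + 1 then 2 / l else 0 := by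
  have hc := kernelFactor_nonneg hl k
  have hd := kernelFactor_add_kernelJump_nonneg hl k
  have nonneg : ∀ j, j ≠ k + 1 → 0 ≤ poissonKernel l k j := by
    intro j hj
    have hp := poissonProb_pos hl j
    rw [poissonKernel, if_neg hj, sub_zero]
    split_ifs
    · rw [← add_mul]; positivity
    · rw [mul_zero, add_zero]; positivity
  by_cases hj : j = k + 1
  · rw [if_pos hj, hj]
    -- the equation at `k + 1` and positivity at `k + 2` bound the value at `k + 1` from below
    have h1 := poissonKernel_rec hl k (k + 1)
    rw [if_pos rfl, if_neg (by omega)] at h1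
    have h2 := nonneg (k + 1 + 1) (by omega)
    have h3 : -(1 / l) ≤ poissonKernel l k (k + 1) := by
      rw [← neg_div, div_le_iff₀ hl]
      have : 0 ≤ ((k + 1 : ℕ) + 1 : ℝ) * poissonKernel l k (k + 1 + 1) := by positivity
      linarith
    have h4 : 2 / l = 1 / l + 1 / l := by ring
    have h5 : 0 < 1 / l := by positivity
    rw [abs_le]
    constructor <;> linarith
  · rw [if_neg hj, add_zero, abs_of_nonneg (nonneg j hj)]

/-- The generating function of `poissonKernel l k` has `ℓ¹` norm at most `2 / l`. This is the
Stein factor for the Poisson law. -/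
theorem tsum_enorm_poissonKernel_le {l : ℝ} (hl : 0 < l) (k : ℕ) :
    ∑' j, ‖poissonKernel l k j‖ₑ ≤ ENNReal.ofReal (2 / l) := by
  have h := l1_le_ofReal (F := PowerSeries.mk (poissonKernel l k))
    ((hasSum_poissonKernel l k).add (hasSum_ite_eq (k + 1) (2 / l)))
    (fun j => by simpa using abs_poissonKernel_le hl k j)
  simpa [l1] using h

/-- Poisson Stein estimate in generating function form: if `D` has total mass `0` and solves
`D' - l D = (X - 1) S`, then `‖D‖₁ ≤ (2 / l) ‖S‖₁`. -/
theorem l1_le_of_derivative_sub_eq {l : ℝ} (hl : 0 < l) {D S : PowerSeries ℝ}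
    (hS : l1 S ≠ ∞) (hD : HasSum (fun j => coeff j D) 0)
    (h : derivative ℝ D - C l * D = (X - 1) * S) :
    l1 D ≤ ENNReal.ofReal (2 / l) * l1 S := by
  set f : ℕ → ℕ → ℝ := fun k j => coeff k S * poissonKernel l k j with hf
  have hbound : ∑' k, ∑' j, ‖f k j‖ₑ ≤ ENNReal.ofReal (2 / l) * l1 S := by
    rw [l1, mul_comm, ← ENNReal.tsum_mul_right]
    refine ENNReal.tsum_le_tsum fun k => ?_
    simp only [hf, enorm_mul, ENNReal.tsum_mul_left]
    gcongr
    exact tsum_enorm_poissonKernel_le hl k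
  have hsum : Summable (Function.uncurry f) := by
    have hfin : ∑' x : ℕ × ℕ, (‖Function.uncurry f x‖₊ : ℝ≥0∞) ≠ ∞ := by
      rw [ENNReal.tsum_prod']
      exact (hbound.trans_lt (ENNReal.mul_lt_top ENNReal.ofReal_lt_top hS.lt_top)).ne
    rw [ENNReal.tsum_coe_ne_top_iff_summable] at hfin
    exact Summable.of_norm (NNReal.summable_coe.2 hfin)
  have hcol : ∀ j, Summable fun k => f k j := fun j =>
    hsum.comp_injective (i := fun k => (k, j)) fun a b hab => (Prod.ext_iff.1 hab).1
  -- superposition of the kernels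
  set E : ℕ → ℝ := fun j => ∑' k, f k j with hE
  have hE0 : HasSum E 0 := by
    have h1 : HasSum (Function.uncurry f) 0 := by
      have h2 := hsum.hasSum
      have h3 : HasSum (fun _ : ℕ => (0 : ℝ)) (∑' x, Function.uncurry f x) :=
        h2.prod_fiberwise fun k => by
          simpa [hf] using (hasSum_poissonKernel l k).mul_left (coeff k S)
      rwa [h3.unique hasSum_zero] at h2
    have h2 : HasSum (fun x : ℕ × ℕ => f x.2 x.1) 0 := (Equiv.prodComm ℕ ℕ).hasSum_iff.2 h1
    exact h2.prod_fiberwise fun j => (hcol j).hasSum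
  have hErec : ∀ j : ℕ, (j + 1) * E (j + 1) - l * E j = coeff j ((X - 1) * S) := by
    intro j
    have h1 : HasSum (fun k => (j + 1) * f k (j + 1) - l * f k j)
        ((j + 1) * E (j + 1) - l * E j) :=
      ((hcol (j + 1)).hasSum.mul_left _).sub ((hcol j).hasSum.mul_left _)
    have h2 : ∀ k, (j + 1) * f k (j + 1) - l * f k j
        = (if j = k + 1 then coeff k S else 0) - if j = k then coeff k S else 0 := by
      intro k
      have := poissonKernel_rec hl k j
      calc (j + 1) * f k (j + 1) - l * f k j
          = coeff k S * ((j + 1) * poissonKernel l k (j + 1) - l * poissonKernel l k j) := by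
            simp only [hf]; ring
        _ = _ := by rw [this, mul_sub, mul_ite, mul_ite]; simp
    simp only [h2] at h1
    refine h1.unique ?_
    rw [sub_mul, one_mul, map_sub]
    refine HasSum.sub ?_ ?_
    · cases j with
      | zero => simp [hasSum_zero]
      | succ j =>
        rw [coeff_succ_X_mul]
        convert! hasSum_ite_eq j (coeff j S) using 2 with k
        by_cases hk : k = j
        · simp [hk]
        · rw [if_neg (by omega), if_neg hk]
    · convert! hasSum_ite_eq j (coeff j S) using 2 with k
      by_cases hk : k = j
      · simp [hk]
      · rw [if_neg (by omega), if_neg hk]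
  -- two solutions differ by a multiple of the Poisson law, which the total mass determines
  have hdiff : ∀ j, coeff j D - E j = (coeff 0 D - E 0) * (l ^ j / j.factorial) := by
    intro j
    induction j with
    | zero => simp
    | succ j ih =>
      have h1 := congrArg (coeff j) h
      rw [map_sub, coeff_derivative, coeff_C_mul, ← hErec j] at h1
      rw [Nat.factorial_succ]
      push_cast
      have h2 : ((j : ℝ) + 1) ≠ 0 := by positivity
      have h3 : (j + 1 : ℝ) * (coeff (j + 1) D - E (j + 1)) = l * (coeff j D - E j) := by
        linear_combination h1
      rw [ih] at h3
      have h4 : (j.factorial : ℝ) ≠ 0 := by positivity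
      field_simp at h3 ⊢
      linear_combination h3
  have hc : coeff 0 D - E 0 = 0 := by
    have h1 : HasSum (fun j => coeff j D - E j) 0 := by
      have := hD.sub hE0
      rwa [sub_zero] at this
    rw [funext hdiff] at h1
    have h2 := (NormedSpace.expSeries_div_hasSum_exp l).mul_left (coeff 0 D - E 0)
    rw [← Real.exp_eq_exp_ℝ] at h2
    have h3 := h1.unique h2
    exact (mul_eq_zero.1 h3.symm).resolve_right (Real.exp_pos l).ne'
  have hDE : ∀ j, coeff j D = E j := fun j => by
    have := hdiff j
    rw [hc, zero_mul] at this
    linarith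
  calc l1 D = ∑' j, ‖∑' k, f k j‖ₑ := by simp only [l1, hDE, hE]
    _ ≤ ∑' j, ∑' k, ‖f k j‖ₑ := ENNReal.tsum_le_tsum fun j => enorm_tsum_le_tsum_enorm
    _ = ∑' k, ∑' j, ‖f k j‖ₑ := ENNReal.tsum_comm
    _ ≤ _ := hbound

end

section

open scoped ENNReal

/-! ### Moments of the cosine and a Bessel function bound -/

theorem integral_cos_pow_zero_two_pi_add_two (m : ℕ) :
    ∫ t in (0 : ℝ)..2 * Real.pi, Real.cos t ^ (m + 2)
      = (m + 1) / (m + 2) * ∫ t in (0 : ℝ)..2 * Real.pi, Real.cos t ^ m := by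
  rw [integral_cos_pow]
  simp

theorem integral_cos_pow_odd_zero_two_pi (k : ℕ) :
    ∫ t in (0 : ℝ)..2 * Real.pi, Real.cos t ^ (2 * k + 1) = 0 := by
  induction k with
  | zero => simp
  | succ k ih =>
    rw [show 2 * (k + 1) + 1 = (2 * k + 1) + 2 by ring, integral_cos_pow_zero_two_pi_add_two, ih,
      mul_zero]

/-- The normalized moments `c` of the cosine satisfy `c ^ 2 * (2 * k + 1) ≤ 1`. -/
theorem sq_integral_cos_pow_even_le (k : ℕ) :
    (∫ t in (0 : ℝ)..2 * Real.pi, Real.cos t ^ (2 * k)) ^ 2 * (2 * k + 1)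
      ≤ (2 * Real.pi) ^ 2 := by
  induction k with
  | zero => simp
  | succ k ih =>
    rw [show 2 * (k + 1) = 2 * k + 2 by ring, integral_cos_pow_zero_two_pi_add_two]
    refine le_trans ?_ ih
    set a := ∫ t in (0 : ℝ)..2 * Real.pi, Real.cos t ^ (2 * k)
    have h : ((((2 * k : ℕ) : ℝ) + 1) / ((2 * k : ℕ) + 2)) ^ 2 * (2 * ((k + 1 : ℕ) : ℝ) + 1)
        ≤ 2 * k + 1 := by
      push_cast
      rw [div_pow, div_mul_eq_mul_div, div_le_iff₀ (by positivity)]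
      nlinarith [(Nat.cast_nonneg k : (0 : ℝ) ≤ k), sq_nonneg (k : ℝ)]
    calc _ = a ^ 2 * (((((2 * k : ℕ) : ℝ) + 1) / ((2 * k : ℕ) + 2)) ^ 2
          * (2 * ((k + 1 : ℕ) : ℝ) + 1)) := by ring
      _ ≤ _ := by gcongr

/-- The weighting of the arithmetic–geometric mean inequality is chosen so that the resulting
terms, summed against `V ^ (2 * k) / (2 * k)!`, give the exponential series of `V`. -/
theorem integral_cos_pow_even_le {V : ℝ} (hV : 0 < V) (k : ℕ) :
    ∫ t in (0 : ℝ)..2 * Real.pi, Real.cos t ^ (2 * k)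
      ≤ Real.pi / √V * (1 + V / (2 * k + 1)) := by
  set a := ∫ t in (0 : ℝ)..2 * Real.pi, Real.cos t ^ (2 * k) with ha
  have h := sq_integral_cos_pow_even_le k
  rw [← ha] at h
  have hs : 0 < √V := Real.sqrt_pos.2 hV
  have hsV : √V ^ 2 = V := Real.sq_sqrt hV.le
  have hpi := Real.pi_pos
  apply le_of_sq_le_sq _ (by positivity)
  have h1 : a ^ 2 ≤ (2 * Real.pi) ^ 2 / (2 * k + 1) := by
    rw [le_div_iff₀ (by positivity)]; exact h
  refine h1.trans ?_
  rw [mul_pow (Real.pi / √V), div_pow Real.pi, hsV]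
  set x : ℝ := 2 * k + 1 with hx
  have hx0 : 0 < x := by positivity
  have : Real.pi ^ 2 / V * (1 + V / x) ^ 2 - (2 * Real.pi) ^ 2 / x
      = Real.pi ^ 2 / V * (1 - V / x) ^ 2 := by field_simp; ring
  have : 0 ≤ Real.pi ^ 2 / V * (1 - V / x) ^ 2 := by positivity
  linarith

theorem hasSum_integral_exp_mul_cos (V : ℝ) :
    HasSum (fun m : ℕ => V ^ m / m.factorial * ∫ t in (0 : ℝ)..2 * Real.pi, Real.cos t ^ m)
      (∫ t in (0 : ℝ)..2 * Real.pi, Real.exp (V * Real.cos t)) := by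
  simp_rw [← intervalIntegral.integral_const_mul]
  refine intervalIntegral.hasSum_integral_of_dominated_convergence
    (fun m _ => |V| ^ m / m.factorial) (fun m => ?_) (fun m => ?_) ?_ ?_ ?_
  · exact (by fun_prop : Continuous fun t : ℝ =>
      V ^ m / m.factorial * Real.cos t ^ m).aestronglyMeasurable
  · refine Filter.Eventually.of_forall fun t _ => ?_
    rw [norm_mul, norm_div, norm_pow, norm_pow, Real.norm_eq_abs, Real.norm_eq_abs,
      Real.norm_eq_abs, Nat.abs_cast]
    exact mul_le_of_le_one_right (by positivity)
      (pow_le_one₀ (abs_nonneg _) (Real.abs_cos_le_one t))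
  · exact Filter.Eventually.of_forall fun t _ => Real.summable_pow_div_factorial _
  · exact intervalIntegrable_const
  · refine Filter.Eventually.of_forall fun t _ => ?_
    have h := NormedSpace.expSeries_div_hasSum_exp (V * Real.cos t)
    rw [← Real.exp_eq_exp_ℝ] at h
    convert! h using 2 with m
    rw [mul_pow]
    ring

/-- The Bessel function bound `exp (-V) * I₀ V ≤ 1 / (2 * √V)`. -/
theorem integral_exp_mul_cos_le {V : ℝ} (hV : 0 < V) :
    ∫ t in (0 : ℝ)..2 * Real.pi, Real.exp (V * Real.cos t)
      ≤ Real.pi / √V * Real.exp V := by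
  have h1 := hasSum_integral_exp_mul_cos V
  have h2 : HasSum (fun k : ℕ => V ^ (2 * k) / (2 * k).factorial
      * ∫ t in (0 : ℝ)..2 * Real.pi, Real.cos t ^ (2 * k))
      (∫ t in (0 : ℝ)..2 * Real.pi, Real.exp (V * Real.cos t)) := by
    refine (Function.Injective.hasSum_iff (g := fun k : ℕ => 2 * k)
      (fun a b h => by simpa using h) fun m hm => ?_).2 h1
    have hodd : Odd m := by
      rw [← Nat.not_even_iff_odd]
      rintro ⟨k, hk⟩
      exact hm ⟨k, by simp only; omega⟩
    obtain ⟨k, rfl⟩ := hodd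
    rw [integral_cos_pow_odd_zero_two_pi, mul_zero]
  have h3 := ((Real.hasSum_cosh V).add (Real.hasSum_sinh V)).mul_left (Real.pi / √V)
  rw [Real.cosh_add_sinh] at h3
  refine hasSum_le (fun k => ?_) h2 h3
  have hw : 0 ≤ V ^ (2 * k) / (2 * k).factorial := by positivity
  refine (mul_le_mul_of_nonneg_left (integral_cos_pow_even_le hV k) hw).trans (le_of_eq ?_)
  rw [Nat.factorial_succ, pow_succ]
  push_cast
  field_simp

end

section

open Polynomial
open scoped ENNReal

/-! ### Unimodality of the Bernoulli sums -/

/-- The generating function of the sum of independent Bernoulli variables with success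
probabilities `p i`, `i ∈ s`. -/
noncomputable def bernoulliPoly {ι : Type*} (p : ι → ℝ) (s : Finset ι) : ℝ[X] :=
  ∏ i ∈ s, (C (1 - p i) + C (p i) * X)

theorem bernoulliPoly_insert {ι : Type*} [DecidableEq ι] (p : ι → ℝ) {s : Finset ι} {i : ι}
    (hi : i ∉ s) :
    bernoulliPoly p (insert i s) = (C (1 - p i) + C (p i) * X) * bernoulliPoly p s :=
  Finset.prod_insert hi

theorem eval_one_bernoulliPoly {ι : Type*} (p : ι → ℝ) (s : Finset ι) :
    (bernoulliPoly p s).eval 1 = 1 := by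
  simp [bernoulliPoly, eval_prod]

/-- The coefficients of a polynomial extended by zero to all integers. -/
noncomputable def coeffInt (F : ℝ[X]) (k : ℤ) : ℝ := if 0 ≤ k then F.coeff k.toNat else 0

theorem coeffInt_natCast (F : ℝ[X]) (n : ℕ) : coeffInt F n = F.coeff n := by
  simp [coeffInt]

theorem coeffInt_linear_mul (a b : ℝ) (F : ℝ[X]) (k : ℤ) :
    coeffInt ((C a + C b * X) * F) k = a * coeffInt F k + b * coeffInt F (k - 1) := by
  rw [add_mul, mul_assoc]
  rcases lt_trichotomy k 0 with h | rfl | h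
  · simp [coeffInt, not_le.2 h, show ¬ (1 ≤ k) by omega]
  · simp [coeffInt]
  · obtain ⟨n, rfl⟩ : ∃ n : ℕ, k = (n + 1 : ℕ) := ⟨(k - 1).toNat, by omega⟩
    rw [show ((n + 1 : ℕ) : ℤ) - 1 = (n : ℕ) by push_cast; ring]
    simp only [coeffInt_natCast, coeff_add, coeff_C_mul, coeff_X_mul]

/-- Nonnegativity together with log-concavity without internal zeros. -/
def IsLogConcave (f : ℤ → ℝ) : Prop :=
  (∀ k, 0 ≤ f k) ∧ ∀ i j, i ≤ j → f (i - 1) * f (j + 1) ≤ f i * f j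

theorem IsLogConcave.bernoulli_conv {f : ℤ → ℝ} (hf : IsLogConcave f) {a b : ℝ} (ha : 0 ≤ a)
    (hb : 0 ≤ b) : IsLogConcave fun k => a * f k + b * f (k - 1) := by
  obtain ⟨h0, h⟩ := hf
  refine ⟨fun k => ?_, fun i j hij => ?_⟩
  · have := h0 k
    have := h0 (k - 1)
    positivity
  have h1 := h i j hij
  have h2 := h (i - 1) (j - 1) (by omega)
  have h3 : f (i - 1 - 1) * f (j + 1) ≤ f i * f (j - 1) := by
    rcases hij.eq_or_lt with rfl | hlt
    · have := h (i - 1) i (by omega)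
      linarith
    · have h4 := h (i - 1) j (by omega)
      have h5 := h i (j - 1) (by omega)
      rw [sub_add_cancel] at h5
      linarith
  simp only [add_sub_cancel_right]
  rw [sub_add_cancel] at h2
  nlinarith [mul_le_mul_of_nonneg_left h1 (mul_nonneg ha ha),
    mul_le_mul_of_nonneg_left h2 (mul_nonneg hb hb),
    mul_le_mul_of_nonneg_left h3 (mul_nonneg ha hb)]

theorem isLogConcave_bernoulliPoly {ι : Type*} (p : ι → ℝ) (s : Finset ι)
    (hp : ∀ i ∈ s, p i ∈ Set.Icc (0 : ℝ) 1) : IsLogConcave (coeffInt (bernoulliPoly p s)) := by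
  classical
  induction s using Finset.induction_on with
  | empty =>
    have h0 : ∀ k, coeffInt (bernoulliPoly p ∅) k = if k = 0 then 1 else 0 := by
      intro k
      simp only [coeffInt, bernoulliPoly, Finset.prod_empty, coeff_one]
      split_ifs <;> first | rfl | omega
    constructor
    · intro k
      rw [h0]
      split_ifs <;> norm_num
    · intro i j hij
      simp only [h0]
      split_ifs <;> first | omega | norm_num
  | insert i s hi ih =>
    have hpi := hp i (Finset.mem_insert_self i s)
    have := (ih fun j hj => hp j (Finset.mem_insert_of_mem hj)).bernoulli_conv
      (sub_nonneg.2 hpi.2) hpi.1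
    rw [bernoulliPoly_insert p hi]
    convert! this using 2
    exact coeffInt_linear_mul _ _ _ _

theorem IsLogConcave.monotone_before {f : ℤ → ℝ} (hf : IsLogConcave f) {m : ℤ}
    (hm : ∀ k, f k ≤ f m) (hpos : 0 < f m) {i : ℤ} (hi : i < m) : f i ≤ f (i + 1) := by
  rcases eq_or_ne (i + 1) m with h | h
  · rw [h]; exact hm i
  have h1 := hf.2 (i + 1) (m - 1) (by omega)
  rw [add_sub_cancel_right, sub_add_cancel] at h1
  have h2 : f i * f m ≤ f (i + 1) * f m :=
    h1.trans (mul_le_mul_of_nonneg_left (hm _) (hf.1 _))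
  exact le_of_mul_le_mul_right h2 hpos

theorem IsLogConcave.antitone_after {f : ℤ → ℝ} (hf : IsLogConcave f) {m : ℤ}
    (hm : ∀ k, f k ≤ f m) (hpos : 0 < f m) {j : ℤ} (hj : m ≤ j) : f (j + 1) ≤ f j := by
  rcases eq_or_ne m j with h | h
  · rw [← h]; exact hm _
  have h1 := hf.2 (m + 1) j (by omega)
  rw [add_sub_cancel_right] at h1
  have h2 : f m * f (j + 1) ≤ f m * f j :=
    h1.trans (mul_le_mul_of_nonneg_right (hm _) (hf.1 _))
  exact le_of_mul_le_mul_left h2 hpos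

/-- The total variation of a nonnegative unimodal sequence is at most twice its maximum. -/
theorem l1_X_sub_one_mul_le_of_unimodal {F : PowerSeries ℝ} {m : ℕ} {c : ℝ}
    (h0 : ∀ n, 0 ≤ PowerSeries.coeff n F)
    (hmono : ∀ n < m, PowerSeries.coeff n F ≤ PowerSeries.coeff (n + 1) F)
    (hanti : ∀ n, m ≤ n → PowerSeries.coeff (n + 1) F ≤ PowerSeries.coeff n F)
    (hm : PowerSeries.coeff m F ≤ c) :
    l1 ((PowerSeries.X - 1) * F) ≤ ENNReal.ofReal (2 * c) := by
  have hz : PowerSeries.coeff 0 ((PowerSeries.X - 1) * F) = -PowerSeries.coeff 0 F := by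
    simp [sub_mul]
  have hs : ∀ n, PowerSeries.coeff (n + 1) ((PowerSeries.X - 1) * F)
      = PowerSeries.coeff n F - PowerSeries.coeff (n + 1) F := by
    intro n
    simp [sub_mul, PowerSeries.coeff_succ_X_mul]
  set u : ℕ → ℝ := fun n => |PowerSeries.coeff n ((PowerSeries.X - 1) * F)| with hu
  have hup : ∀ N ≤ m, ∑ n ∈ Finset.range (N + 1), u n = PowerSeries.coeff N F := by
    intro N
    induction N with
    | zero =>
      intro _
      rw [Finset.sum_range_one]
      simp only [hu]
      rw [hz, abs_neg, abs_of_nonneg (h0 0)]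
    | succ N ih =>
      intro hN
      rw [Finset.sum_range_succ, ih (by omega)]
      simp only [hu, hs]
      rw [abs_of_nonpos (sub_nonpos.2 (hmono N (by omega)))]
      ring
  have hdown : ∀ N, m ≤ N → ∑ n ∈ Finset.range (N + 1), u n
      = 2 * PowerSeries.coeff m F - PowerSeries.coeff N F := by
    intro N hN
    induction N, hN using Nat.le_induction with
    | base => rw [hup m le_rfl]; ring
    | succ N hN ih =>
      rw [Finset.sum_range_succ, ih]
      simp only [hu, hs]
      rw [abs_of_nonneg (sub_nonneg.2 (hanti N hN))]
      ring
  unfold l1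
  refine ENNReal.tsum_le_of_sum_range_le fun N => ?_
  calc ∑ n ∈ Finset.range N, ‖PowerSeries.coeff n ((PowerSeries.X - 1) * F)‖ₑ
      = ENNReal.ofReal (∑ n ∈ Finset.range N, u n) := by
        rw [ENNReal.ofReal_sum_of_nonneg fun n _ => abs_nonneg _]
        simp only [Real.enorm_eq_ofReal_abs]
    _ ≤ ENNReal.ofReal (∑ n ∈ Finset.range (N + m + 1), u n) := by
        refine ENNReal.ofReal_le_ofReal (Finset.sum_le_sum_of_subset_of_nonneg ?_ ?_)
        · exact Finset.range_subset_range.2 (by omega)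
        · exact fun n _ _ => abs_nonneg _
    _ ≤ ENNReal.ofReal (2 * c) := by
        refine ENNReal.ofReal_le_ofReal ?_
        rw [hdown _ (by omega)]
        linarith [h0 (N + m)]

/-! ### Fourier bound for the largest point probability -/

theorem integral_exp_int_mul_I (k : ℤ) :
    ∫ t in (0 : ℝ)..2 * Real.pi, Complex.exp (k * Complex.I * t)
      = if k = 0 then 2 * (Real.pi : ℂ) else 0 := by
  split_ifs with hk
  · simp [hk]
  · have hk' : (k : ℂ) * Complex.I ≠ 0 := mul_ne_zero (by exact_mod_cast hk) Complex.I_ne_zero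
    rw [integral_exp_mul_complex hk']
    have h1 : (k : ℂ) * Complex.I * ((2 * Real.pi : ℝ) : ℂ) = k * (2 * Real.pi * Complex.I) := by
      push_cast; ring
    rw [h1, Complex.exp_int_mul_two_pi_mul_I]
    simp

theorem two_pi_mul_abs_coeff_le (F : ℝ[X]) (k : ℕ) :
    2 * Real.pi * |F.coeff k| ≤ ∫ t in (0 : ℝ)..2 * Real.pi,
      ‖F.aeval (Complex.exp (t * Complex.I))‖ := by
  have h : ∫ t in (0 : ℝ)..2 * Real.pi,
      Complex.exp (-(k * Complex.I * t)) * F.aeval (Complex.exp (t * Complex.I))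
        = 2 * Real.pi * F.coeff k := by
    have h1 : ∀ t : ℝ, Complex.exp (-(k * Complex.I * t)) * F.aeval (Complex.exp (t * Complex.I))
        = ∑ n ∈ Finset.range (F.natDegree + 1),
          (F.coeff n : ℂ) * Complex.exp (((n - k : ℤ) : ℂ) * Complex.I * t) := by
      intro t
      rw [aeval_eq_sum_range, Finset.mul_sum]
      refine Finset.sum_congr rfl fun n _ => ?_
      rw [← Complex.exp_nat_mul, Complex.real_smul, mul_left_comm, ← Complex.exp_add]
      congr 2
      push_cast
      ring
    simp only [h1]
    rw [intervalIntegral.integral_finsetSum]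
    · simp only [intervalIntegral.integral_const_mul, integral_exp_int_mul_I]
      simp only [sub_eq_zero, Nat.cast_inj, mul_ite, mul_zero, Finset.sum_ite_eq',
        Finset.mem_range]
      split_ifs with hk
      · ring
      · rw [coeff_eq_zero_of_natDegree_lt (by omega)]
        simp
    · intro n _
      exact (by fun_prop : Continuous fun t : ℝ => (F.coeff n : ℂ)
        * Complex.exp (((n - k : ℤ) : ℂ) * Complex.I * t)).intervalIntegrable _ _
  have h2 : 2 * Real.pi * |F.coeff k| = ‖(2 * Real.pi * F.coeff k : ℂ)‖ := by
    rw [norm_mul, norm_mul, Complex.norm_real, Complex.norm_real, Real.norm_eq_abs,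
      Real.norm_eq_abs, abs_of_pos Real.pi_pos]
    simp
  rw [h2, ← h]
  refine (intervalIntegral.norm_integral_le_integral_norm (by positivity)).trans (le_of_eq ?_)
  refine intervalIntegral.integral_congr fun t _ => ?_
  simp only [norm_mul]
  rw [show -(k * Complex.I * t) = ((-(k * t) : ℝ) : ℂ) * Complex.I by push_cast; ring,
    Complex.norm_exp_ofReal_mul_I, one_mul]

theorem norm_bernoulli_charFun_le (r t : ℝ) :
    ‖((1 - r : ℝ) : ℂ) + (r : ℂ) * Complex.exp (t * Complex.I)‖
      ≤ Real.exp (-(r * (1 - r)) * (1 - Real.cos t)) := by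
  apply le_of_sq_le_sq _ (Real.exp_pos _).le
  rw [← Complex.normSq_eq_norm_sq, Complex.normSq_apply, ← Real.exp_nat_mul,
    Complex.exp_ofReal_mul_I]
  refine le_trans (le_of_eq ?_) (Real.add_one_le_exp _)
  simp only [Complex.add_re, Complex.add_im, Complex.mul_re, Complex.mul_im, Complex.ofReal_re,
    Complex.ofReal_im, Complex.I_re, Complex.I_im]
  push_cast
  linear_combination r ^ 2 * Real.sin_sq_add_cos_sq t

theorem norm_aeval_bernoulliPoly_le {ι : Type*} (p : ι → ℝ) (s : Finset ι) (t : ℝ) :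
    ‖(bernoulliPoly p s).aeval (Complex.exp (t * Complex.I))‖
      ≤ Real.exp (-(∑ i ∈ s, p i * (1 - p i)) * (1 - Real.cos t)) := by
  rw [← Finset.sum_neg_distrib, Finset.sum_mul, Real.exp_sum, bernoulliPoly, map_prod, norm_prod]
  refine Finset.prod_le_prod (fun i _ => norm_nonneg _) fun i _ => ?_
  refine le_trans (le_of_eq ?_) (norm_bernoulli_charFun_le (p i) t)
  simp

theorem abs_coeff_bernoulliPoly_le {ι : Type*} (p : ι → ℝ) (s : Finset ι)
    (hV : 0 < ∑ i ∈ s, p i * (1 - p i)) (k : ℕ) :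
    |(bernoulliPoly p s).coeff k| ≤ 1 / (2 * √(∑ i ∈ s, p i * (1 - p i))) := by
  set V := ∑ i ∈ s, p i * (1 - p i) with hVdef
  have hpi := Real.pi_pos
  have hs : 0 < √V := Real.sqrt_pos.2 hV
  have h1 : 2 * Real.pi * |(bernoulliPoly p s).coeff k|
      ≤ ∫ t in (0 : ℝ)..2 * Real.pi, Real.exp (-V) * Real.exp (V * Real.cos t) := by
    refine (two_pi_mul_abs_coeff_le _ k).trans ?_
    refine intervalIntegral.integral_mono_on (by positivity) ?_ ?_ fun t _ => ?_
    · refine Continuous.intervalIntegrable ?_ _ _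
      have : Continuous fun z : ℂ => aeval z (bernoulliPoly p s) :=
        (bernoulliPoly p s).continuous_aeval
      fun_prop
    · exact Continuous.intervalIntegrable (by fun_prop) _ _
    · refine (norm_aeval_bernoulliPoly_le p s t).trans (le_of_eq ?_)
      rw [← Real.exp_add]
      congr 1
      ring
  rw [intervalIntegral.integral_const_mul] at h1
  have h2 := h1.trans (mul_le_mul_of_nonneg_left (integral_exp_mul_cos_le hV) (Real.exp_pos _).le)
  have h3 : Real.exp (-V) * (Real.pi / √V * Real.exp V) = 2 * Real.pi * (1 / (2 * √V)) := by
    rw [mul_left_comm, ← Real.exp_add, neg_add_cancel, Real.exp_zero]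
    field_simp
  rw [h3] at h2
  exact le_of_mul_le_mul_left h2 (by positivity)

/-! ### Smoothness of the Bernoulli sums -/

/-- The law of a Bernoulli sum with variance `V` and its shift by one are at distance at most
`1 / √V`. -/
theorem l1_X_sub_one_mul_bernoulliPoly_le {ι : Type*} (p : ι → ℝ) (s : Finset ι)
    (hp : ∀ i ∈ s, p i ∈ Set.Icc (0 : ℝ) 1) (hV : 0 < ∑ i ∈ s, p i * (1 - p i)) :
    l1 ((PowerSeries.X - 1) * (bernoulliPoly p s : PowerSeries ℝ))
      ≤ ENNReal.ofReal (1 / √(∑ i ∈ s, p i * (1 - p i))) := by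
  set F := bernoulliPoly p s with hF
  have hlc := isLogConcave_bernoulliPoly p s hp
  rw [← hF] at hlc
  have h0 : ∀ n, 0 ≤ F.coeff n := fun n => by
    have := hlc.1 n
    rwa [coeffInt_natCast] at this
  have hF0 : F ≠ 0 := by
    intro h
    have := eval_one_bernoulliPoly p s
    rw [← hF, h, eval_zero] at this
    exact zero_ne_one this
  obtain ⟨m, -, hm⟩ := (Finset.range (F.natDegree + 1)).exists_max_image (fun n => F.coeff n)
    ⟨0, by simp⟩
  have hmax : ∀ n, F.coeff n ≤ F.coeff m := by
    intro n
    by_cases hn : n ∈ Finset.range (F.natDegree + 1)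
    · exact hm n hn
    · rw [coeff_eq_zero_of_natDegree_lt (by simpa using hn)]
      exact h0 m
  have hpos : 0 < F.coeff m :=
    lt_of_lt_of_le (lt_of_le_of_ne (h0 _) (leadingCoeff_ne_zero.2 hF0).symm) (hmax F.natDegree)
  have hmaxZ : ∀ k : ℤ, coeffInt F k ≤ coeffInt F m := by
    intro k
    rw [coeffInt_natCast, coeffInt]
    split_ifs
    · exact hmax _
    · exact h0 m
  have hposZ : 0 < coeffInt F m := by rwa [coeffInt_natCast]
  have h := l1_X_sub_one_mul_le_of_unimodal (F := (F : PowerSeries ℝ)) (m := m)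
    (c := 1 / (2 * √(∑ i ∈ s, p i * (1 - p i)))) (fun n => by simpa using h0 n)
    (fun n hn => ?_) (fun n hn => ?_) ?_
  · refine h.trans (le_of_eq ?_)
    congr 1
    field_simp
  · have := hlc.monotone_before hmaxZ hposZ (i := n) (by exact_mod_cast hn)
    rw [coeffInt_natCast, show (n : ℤ) + 1 = (n + 1 : ℕ) by push_cast; ring,
      coeffInt_natCast] at this
    simpa using this
  · have := hlc.antitone_after hmaxZ hposZ (j := n) (by exact_mod_cast hn)
    rw [coeffInt_natCast, show (n : ℤ) + 1 = (n + 1 : ℕ) by push_cast; ring,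
      coeffInt_natCast] at this
    simpa using this
  · rw [Polynomial.coeff_coe]
    exact (le_abs_self _).trans (abs_coeff_bernoulliPoly_le p s hV m)

/-- Weights in `[0, τ]` can be split into two groups whose totals differ by at most `τ`. -/
theorem exists_balanced_split {ι : Type*} [DecidableEq ι] (v : ι → ℝ) {τ : ℝ} (hτ : 0 ≤ τ)
    (s : Finset ι) (hv : ∀ i ∈ s, 0 ≤ v i ∧ v i ≤ τ) :
    ∃ t ⊆ s, |∑ i ∈ t, v i - ∑ i ∈ s \ t, v i| ≤ τ := by
  induction s using Finset.induction_on with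
  | empty => exact ⟨∅, subset_rfl, by simpa using hτ⟩
  | insert i s hi ih =>
    obtain ⟨t, hts, ht⟩ := ih fun j hj => hv j (Finset.mem_insert_of_mem hj)
    have hvi := hv i (Finset.mem_insert_self i s)
    have hit : i ∉ t := fun h => hi (hts h)
    rw [abs_le] at ht
    -- the new weight joins the lighter group
    rcases le_total (∑ i ∈ t, v i) (∑ i ∈ s \ t, v i) with h | h
    · refine ⟨insert i t, Finset.insert_subset_insert i hts, ?_⟩
      rw [Finset.sum_insert hit, Finset.insert_sdiff_insert,
        Finset.sdiff_insert_of_notMem hi, abs_le]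
      constructor <;> linarith
    · refine ⟨t, hts.trans (Finset.subset_insert i s), ?_⟩
      rw [Finset.insert_sdiff_of_notMem _ hit, Finset.sum_insert (by simp [hi]), abs_le]
      constructor <;> linarith

theorem l1_X_sub_one_sq_mul_bernoulliPoly_le {ι : Type*} (p : ι → ℝ) (s : Finset ι)
    (hp : ∀ i ∈ s, p i ∈ Set.Icc (0 : ℝ) 1) {τ : ℝ} (hτ0 : 0 ≤ τ)
    (hτ : ∀ i ∈ s, p i * (1 - p i) ≤ τ) (hV : τ < ∑ i ∈ s, p i * (1 - p i)) :
    l1 ((PowerSeries.X - 1) ^ 2 * (bernoulliPoly p s : PowerSeries ℝ))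
      ≤ ENNReal.ofReal
        (2 / √((∑ i ∈ s, p i * (1 - p i)) * (∑ i ∈ s, p i * (1 - p i) - τ))) := by
  classical
  obtain ⟨t, hts, ht⟩ := exists_balanced_split (fun i => p i * (1 - p i)) hτ0 s fun i hi =>
    ⟨mul_nonneg (hp i hi).1 (sub_nonneg.2 (hp i hi).2), hτ i hi⟩
  have hsum := Finset.sum_sdiff (f := fun i => p i * (1 - p i)) hts
  set V := ∑ i ∈ s, p i * (1 - p i)
  set A := ∑ i ∈ t, p i * (1 - p i) with hA
  set B := ∑ i ∈ s \ t, p i * (1 - p i) with hB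
  rw [abs_le] at ht
  have hA0 : 0 < A := by linarith
  have hB0 : 0 < B := by linarith
  have hprod : (bernoulliPoly p s : PowerSeries ℝ)
      = (bernoulliPoly p t : PowerSeries ℝ) * (bernoulliPoly p (s \ t) : PowerSeries ℝ) := by
    rw [← Polynomial.coe_mul, bernoulliPoly, bernoulliPoly, bernoulliPoly, mul_comm,
      Finset.prod_sdiff hts]
  have hfac : (PowerSeries.X - 1) ^ 2 * (bernoulliPoly p s : PowerSeries ℝ)
      = ((PowerSeries.X - 1) * (bernoulliPoly p t : PowerSeries ℝ))
        * ((PowerSeries.X - 1) * (bernoulliPoly p (s \ t) : PowerSeries ℝ)) := by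
    rw [hprod]; ring
  rw [hfac]
  refine (l1_mul_le _ _).trans ((mul_le_mul'
    (l1_X_sub_one_mul_bernoulliPoly_le p t (fun i hi => hp i (hts hi)) hA0)
    (l1_X_sub_one_mul_bernoulliPoly_le p (s \ t)
      (fun i hi => hp i (Finset.sdiff_subset hi)) hB0)).trans ?_)
  rw [← hA, ← hB, ← ENNReal.ofReal_mul (by positivity)]
  refine ENNReal.ofReal_le_ofReal ?_
  rw [div_mul_div_comm, one_mul, ← Real.sqrt_mul hA0.le]
  have hVpos : 0 < V * (V - τ) := mul_pos (by linarith) (by linarith)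
  rw [div_le_div_iff₀ (Real.sqrt_pos.2 (by positivity)) (Real.sqrt_pos.2 hVpos), one_mul]
  rw [show (2 : ℝ) = √(2 ^ 2) by rw [Real.sqrt_sq]; norm_num, ← Real.sqrt_mul (by positivity)]
  refine Real.sqrt_le_sqrt ?_
  -- `4 A B = V ^ 2 - (A - B) ^ 2 ≥ V ^ 2 - τ ^ 2 ≥ V (V - τ)`
  have h1 : (A - B) ^ 2 ≤ τ ^ 2 := sq_le_sq' ht.1 ht.2
  have h2 : V = A + B := by linarith
  nlinarith [mul_nonneg hτ0 (by linarith : 0 ≤ V - τ)]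

end

section

open PowerSeries
open scoped ENNReal

/-! ### Generating functions of laws on the natural numbers -/

/-- The generating function of a law on `ℕ`, as a formal power series. -/
noncomputable def pgf (μ : Measure ℕ) : PowerSeries ℝ := PowerSeries.mk fun j => μ.real {j}

@[simp]
theorem coeff_pgf (μ : Measure ℕ) (j : ℕ) : coeff j (pgf μ) = μ.real {j} := coeff_mk _ _

theorem hasSum_measureReal_singleton (μ : Measure ℕ) [IsProbabilityMeasure μ] :
    HasSum (fun j => μ.real {j}) 1 := by
  have h : ∑' j : ℕ, μ {j} = 1 := by
    have := tsum_measure_preimage_singleton (μ := μ) (f := id) Set.countable_univ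
      fun y _ => measurableSet_eq
    rw [tsum_univ fun j => μ (id ⁻¹' {j})] at this
    simpa using this
  have h2 : Summable fun j : ℕ => μ.real {j} :=
    ENNReal.summable_toReal (by rw [h]; exact ENNReal.one_ne_top)
  rw [h2.hasSum_iff]
  simp only [measureReal_def]
  rw [← ENNReal.tsum_toReal_eq fun j => measure_ne_top μ _, h, ENNReal.toReal_one]

theorem l1_pgf (μ : Measure ℕ) [IsProbabilityMeasure μ] : l1 (pgf μ) = 1 := by
  have h := hasSum_measureReal_singleton μ
  unfold l1
  simp only [coeff_pgf, Real.enorm_eq_ofReal measureReal_nonneg]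
  rw [← ENNReal.ofReal_tsum_of_nonneg (fun _ => measureReal_nonneg) h.summable, h.tsum_eq,
    ENNReal.ofReal_one]

theorem pgf_conv (μ ν : Measure ℕ) [IsProbabilityMeasure μ] [IsProbabilityMeasure ν] :
    pgf (μ.conv ν) = pgf μ * pgf ν := by
  ext n
  rw [coeff_pgf, coeff_mul, Measure.conv, map_measureReal_apply (by fun_prop)
    (MeasurableSet.singleton n)]
  have : (fun x : ℕ × ℕ => x.1 + x.2) ⁻¹' {n}
      = ⋃ x ∈ Finset.HasAntidiagonal.antidiagonal n, {x.1} ×ˢ {x.2} := by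
    ext x
    simp [Prod.ext_iff]
  rw [this, measureReal_biUnion_finset]
  · simp only [measureReal_prod_prod, coeff_pgf]
  · intro x _ y _ hxy
    rw [Function.onFun, Set.disjoint_left]
    rintro z ⟨h1, h2⟩ ⟨h3, h4⟩
    simp only [Set.mem_singleton_iff] at h1 h2 h3 h4
    exact hxy (Prod.ext (h1.symm.trans h3) (h2.symm.trans h4))
  · exact fun x _ => (MeasurableSet.singleton _).prod (MeasurableSet.singleton _)

theorem tvNorm_eq (μ ν : Measure ℕ) : tvNorm μ ν = (l1 (pgf μ - pgf ν)).toReal := by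
  rw [toReal_l1]
  simp [tvNorm]

theorem pmfInt_natCast (μ : Measure ℕ) (n : ℕ) : pmfInt μ n = μ.real {n} := by
  simp [pmfInt]

theorem pmfInt_of_neg (μ : Measure ℕ) {k : ℤ} (hk : k < 0) : pmfInt μ k = 0 := by
  have : {j : ℕ | (j : ℤ) = k} = ∅ := by
    ext j
    simp only [Set.mem_ofPred_eq, Set.mem_empty_iff_false, iff_false]
    omega
  rw [pmfInt, this, measureReal_empty]

theorem secondDiffNorm_eq (μ : Measure ℕ) :
    secondDiffNorm μ = (l1 ((X - 1) ^ 2 * pgf μ)).toReal := by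
  rw [toReal_l1, secondDiffNorm]
  set u : ℤ → ℝ := fun k => |pmfInt μ (k + 2) - 2 * pmfInt μ (k + 1) + pmfInt μ k| with hu
  -- the `n`-th coefficient is the second difference at `n - 2`
  have hinj : Function.Injective fun n : ℕ => (n : ℤ) - 2 := fun a b h => by
    simpa using h
  have hsupp : Function.support u ⊆ Set.range fun n : ℕ => (n : ℤ) - 2 := by
    intro k hk
    by_contra hcon
    refine hk ?_
    have hk2 : k < -2 := by
      by_contra hk3
      exact hcon ⟨(k + 2).toNat, by simp only; omega⟩
    simp only [hu]
    rw [pmfInt_of_neg μ (by omega), pmfInt_of_neg μ (by omega), pmfInt_of_neg μ (by omega)]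
    simp
  rw [← hinj.tsum_eq hsupp]
  refine tsum_congr fun n => ?_
  simp only [hu]
  have hexp : (X - 1 : PowerSeries ℝ) ^ 2 * pgf μ
      = X * (X * pgf μ) - (X * pgf μ + X * pgf μ) + pgf μ := by ring
  rw [hexp]
  congr 1
  rcases n with _ | _ | n
  · rw [pmfInt_of_neg μ (k := ((0 : ℕ) : ℤ) - 2) (by norm_num),
      pmfInt_of_neg μ (k := ((0 : ℕ) : ℤ) - 2 + 1) (by norm_num)]
    rw [show ((0 : ℕ) : ℤ) - 2 + 2 = (0 : ℕ) by norm_num, pmfInt_natCast]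
    simp only [map_add, map_sub, coeff_zero_X_mul, coeff_pgf]
    ring
  · rw [pmfInt_of_neg μ (k := ((0 + 1 : ℕ) : ℤ) - 2) (by norm_num)]
    rw [show ((0 + 1 : ℕ) : ℤ) - 2 + 2 = (1 : ℕ) by norm_num,
      show ((0 + 1 : ℕ) : ℤ) - 2 + 1 = (0 : ℕ) by norm_num, pmfInt_natCast, pmfInt_natCast]
    simp only [map_add, map_sub, coeff_succ_X_mul, coeff_zero_X_mul, coeff_pgf]
    ring_nf
  · rw [show ((n + 1 + 1 : ℕ) : ℤ) - 2 + 2 = (n + 1 + 1 : ℕ) by ring,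
      show ((n + 1 + 1 : ℕ) : ℤ) - 2 + 1 = (n + 1 : ℕ) by push_cast; ring,
      show ((n + 1 + 1 : ℕ) : ℤ) - 2 = (n : ℕ) by push_cast; ring]
    simp only [pmfInt_natCast, map_add, map_sub, coeff_succ_X_mul, coeff_pgf]
    ring

section Bernoulli

variable {Ω : Type*} [MeasurableSpace Ω] {P : Measure Ω} [IsProbabilityMeasure P] {n : ℕ}
  {p : Fin n → ℝ} {X : Fin n → Ω → ℕ}

theorem IsIndepBernoulli.mem_Icc (hX : IsIndepBernoulli P X p) (i : Fin n) :
    p i ∈ Set.Icc (0 : ℝ) 1 := by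
  rw [← hX.prob_one i]
  exact ⟨measureReal_nonneg, measureReal_le_one⟩

theorem IsIndepBernoulli.pgf_map (hX : IsIndepBernoulli P X p) (i : Fin n) :
    pgf (P.map (X i)) = C (1 - p i) + C (p i) * PowerSeries.X := by
  have hprob : IsProbabilityMeasure (P.map (X i)) :=
    Measure.isProbabilityMeasure_map (hX.measurable i).aemeasurable
  have hval : ∀ j, (P.map (X i)).real {j} = P.real {ω | X i ω = j} := fun j => by
    rw [map_measureReal_apply (hX.measurable i) (MeasurableSet.singleton j)]
    rfl
  have h0 : (P.map (X i)).real {0} = 1 - p i := by rw [hval, hX.prob_zero]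
  have h1 : (P.map (X i)).real {1} = p i := by rw [hval, hX.prob_one]
  have hrest : ∀ j, (P.map (X i)).real {j + 2} = 0 := by
    have h := (hasSum_nat_add_iff' 2).2 (hasSum_measureReal_singleton (P.map (X i)))
    rw [Finset.sum_range_succ, Finset.sum_range_one, h0, h1,
      show (1 : ℝ) - (1 - p i + p i) = 0 by ring,
      hasSum_zero_iff_of_nonneg fun _ => measureReal_nonneg] at h
    exact fun j => congrFun h j
  ext j
  rw [coeff_pgf]
  rcases j with _ | _ | j
  · rw [h0]; simp
  · rw [h1]; simp [coeff_C]
  · rw [hrest]; simp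

theorem IsIndepBernoulli.pgf_map_sum (hX : IsIndepBernoulli P X p) (s : Finset (Fin n)) :
    pgf (P.map fun ω => ∑ j ∈ s, X j ω) = (bernoulliPoly p s : PowerSeries ℝ) := by
  induction s using Finset.induction_on with
  | empty =>
    ext j
    simp only [Finset.sum_empty, Measure.map_const, measure_univ, one_smul, coeff_pgf,
      bernoulliPoly, Finset.prod_empty, Polynomial.coe_one, coeff_one]
    rw [measureReal_def, Measure.dirac_apply' _ (MeasurableSet.singleton j)]
    by_cases h : j = 0
    · simp [h]
    · simp [h, Ne.symm h]
  | insert i s hi ih =>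
    have hind : IndepFun (X i) (∑ j ∈ s, X j) P :=
      (hX.indep.indepFun_finsetSum_of_notMem hX.measurable hi).symm
    have hs : (∑ j ∈ s, X j) = fun ω => ∑ j ∈ s, X j ω := by
      ext ω; simp
    have hmeas : Measurable fun ω => ∑ j ∈ s, X j ω :=
      Finset.measurable_sum s fun j _ => hX.measurable j
    have hmap := hind.map_add_eq_map_conv_map (hX.measurable i) (by rw [hs]; exact hmeas)
    rw [hs] at hmap
    have : (fun ω => ∑ j ∈ insert i s, X j ω) = X i + fun ω => ∑ j ∈ s, X j ω := by
      ext ω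
      rw [Finset.sum_insert hi]
      rfl
    have h1 : IsProbabilityMeasure (P.map (X i)) :=
      Measure.isProbabilityMeasure_map (hX.measurable i).aemeasurable
    have h2 : IsProbabilityMeasure (P.map fun ω => ∑ j ∈ s, X j ω) :=
      Measure.isProbabilityMeasure_map hmeas.aemeasurable
    rw [this, hmap, pgf_conv, ih, hX.pgf_map, bernoulliPoly_insert p hi]
    simp

end Bernoulli

theorem derivative_pgf_poissonMeasure (a : NNReal) :
    derivative ℝ (pgf (poissonMeasure a)) = C (a : ℝ) * pgf (poissonMeasure a) := by
  ext j
  rw [coeff_derivative, coeff_C_mul, coeff_pgf, coeff_pgf, poissonMeasure_real_singleton,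
    poissonMeasure_real_singleton, Nat.factorial_succ]
  push_cast
  field_simp
  ring

theorem pgf_binomial (m : ℕ) (r : unitInterval) :
    pgf (binomial m r) = (C (1 - (r : ℝ)) + C (r : ℝ) * X) ^ m := by
  ext j
  rw [coeff_pgf, binomial_real_singleton, add_comm, add_pow, map_sum]
  have h : ∀ k ∈ Finset.range (m + 1),
      coeff j ((C (r : ℝ) * X) ^ k * C (1 - (r : ℝ)) ^ (m - k) * (m.choose k : PowerSeries ℝ))
        = if k = j then m.choose j * (r : ℝ) ^ j * (1 - r) ^ (m - j) else 0 := by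
    intro k _
    have h1 : (C (r : ℝ) * X) ^ k * C (1 - (r : ℝ)) ^ (m - k) * (m.choose k : PowerSeries ℝ)
        = C (m.choose k * (r : ℝ) ^ k * (1 - r) ^ (m - k)) * X ^ k := by
      simp only [mul_pow, map_mul, map_pow, map_natCast]
      ring
    rw [h1, coeff_C_mul, coeff_X_pow]
    split_ifs with h2 h3 h3
    · rw [h3, mul_one]
    · exact absurd h2.symm h3
    · exact absurd h3.symm h2
    · rw [mul_zero]
  rw [Finset.sum_congr rfl h, Finset.sum_ite_eq']
  split_ifs with hj
  · rfl
  · rw [Nat.choose_eq_zero_of_lt (by simpa using hj)]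
    simp

/-- Stein identity of the convolution of a Poisson and a binomial law. -/
theorem derivative_pgf_poissonBinomial (a : NNReal) (m : ℕ) (r : unitInterval) :
    (1 + C (r : ℝ) * (X - 1)) * derivative ℝ (pgf (poissonBinomial a m r))
      = (C (a : ℝ) * (1 + C (r : ℝ) * (X - 1)) + C (m * r : ℝ))
        * pgf (poissonBinomial a m r) := by
  rw [poissonBinomial, pgf_conv, pgf_binomial, Derivation.leibniz, derivative_pgf_poissonMeasure,
    smul_eq_mul, smul_eq_mul, derivative_pow]
  have hlin : C (1 - (r : ℝ)) + C (r : ℝ) * X = 1 + C (r : ℝ) * (X - 1) := by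
    rw [map_sub, map_one]; ring
  have hd : derivative ℝ (C (1 - (r : ℝ)) + C (r : ℝ) * X) = C (r : ℝ) := by
    rw [map_add, derivative_C, Derivation.leibniz, derivative_C, derivative_X]
    simp
  rw [hd, hlin, map_mul, map_natCast]
  cases m with
  | zero => simp; ring
  | succ m =>
    rw [Nat.add_sub_cancel, pow_succ]
    ring

end

section

open PowerSeries
open scoped ENNReal

/-! ### The Stein equation of the approximation error -/

theorem l1_add_le_ofReal {F G : PowerSeries ℝ} {u v : ℝ} (hu : 0 ≤ u) (hv : 0 ≤ v)
    (hF : l1 F ≤ ENNReal.ofReal u) (hG : l1 G ≤ ENNReal.ofReal v) :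
    l1 (F + G) ≤ ENNReal.ofReal (u + v) := by
  rw [ENNReal.ofReal_add hu hv]
  exact (l1_add_le F G).trans (add_le_add hF hG)

theorem l1_C_mul_le_ofReal {F : PowerSeries ℝ} {a u : ℝ} (ha : 0 ≤ a)
    (hF : l1 F ≤ ENNReal.ofReal u) : l1 (C a * F) ≤ ENNReal.ofReal (a * u) := by
  rw [l1_C_mul, Real.enorm_eq_ofReal ha, ENNReal.ofReal_mul ha]
  gcongr

/-- The inverse of `1 + r (X - 1)` as a power series. -/
noncomputable def linearInv (r : ℝ) : PowerSeries ℝ :=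
  PowerSeries.mk fun k => 1 / (1 - r) * (-r / (1 - r)) ^ k

theorem mul_linearInv {r : ℝ} (hr : r < 1) : (1 + C r * (X - 1)) * linearInv r = 1 := by
  have h : 1 - r ≠ 0 := by linarith
  have hlin : (1 + C r * (X - 1)) * linearInv r
      = C (1 - r) * linearInv r + C r * (X * linearInv r) := by
    rw [map_sub, map_one]; ring
  rw [hlin]
  ext k
  rw [map_add, coeff_C_mul, coeff_C_mul, coeff_one]
  rcases k with _ | k
  · rw [coeff_zero_X_mul, linearInv, coeff_mk]
    field_simp
    simp
  · rw [coeff_succ_X_mul, linearInv, coeff_mk, coeff_mk, if_neg (by omega), pow_succ]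
    field_simp
    ring

theorem l1_linearInv_le {r : ℝ} (hr0 : 0 ≤ r) (hr : r < 1 / 2) :
    l1 (linearInv r) ≤ ENNReal.ofReal (1 / (1 - 2 * r)) := by
  have h : 0 < 1 - r := by linarith
  have h' : 0 < 1 - 2 * r := by linarith
  have hgeom := (hasSum_geometric_of_lt_one (r := r / (1 - r)) (by positivity)
    (by rw [div_lt_one h]; linarith)).mul_left (1 / (1 - r))
  have : 1 / (1 - r) * (1 - r / (1 - r))⁻¹ = 1 / (1 - 2 * r) := by
    rw [one_sub_div h.ne', show 1 - r - r = 1 - 2 * r by ring]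
    field_simp
  rw [this] at hgeom
  refine l1_le_ofReal hgeom fun k => le_of_eq ?_
  rw [linearInv, coeff_mk, abs_mul, abs_pow, abs_div, abs_div, abs_neg, abs_one,
    abs_of_nonneg h.le, abs_of_nonneg hr0]

theorem bernoulliPoly_eq_mul_erase {ι : Type*} [DecidableEq ι] (p : ι → ℝ) {s : Finset ι} {i : ι}
    (hi : i ∈ s) : (bernoulliPoly p s : PowerSeries ℝ)
      = (1 + C (p i) * (X - 1)) * (bernoulliPoly p (s.erase i) : PowerSeries ℝ) := by
  rw [← Finset.insert_erase hi, bernoulliPoly_insert p (Finset.notMem_erase i s),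
    Finset.erase_insert (Finset.notMem_erase i s), Polynomial.coe_mul]
  congr 1
  rw [Polynomial.coe_add, Polynomial.coe_mul, Polynomial.coe_C, Polynomial.coe_C,
    Polynomial.coe_X, map_sub, map_one]
  ring

theorem derivative_bernoulliPoly {ι : Type*} [DecidableEq ι] (p : ι → ℝ) (s : Finset ι) :
    derivative ℝ (bernoulliPoly p s : PowerSeries ℝ)
      = ∑ i ∈ s, C (p i) * (bernoulliPoly p (s.erase i) : PowerSeries ℝ) := by
  rw [derivative_coe, bernoulliPoly, Polynomial.derivative_prod_finset]
  have : ∀ i, Polynomial.derivative (Polynomial.C (1 - p i) + Polynomial.C (p i) * Polynomial.X)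
      = Polynomial.C (p i) := by
    intro i; simp
  simp only [this, ← Polynomial.coeToPowerSeries.ringHom_apply, map_sum, map_mul]
  refine Finset.sum_congr rfl fun i _ => ?_
  rw [mul_comm]
  simp [bernoulliPoly]

/-- Third order expansion of the Stein identity of a Bernoulli sum. -/
theorem derivative_bernoulliPoly_expand {ι : Type*} [DecidableEq ι] (p : ι → ℝ) (s : Finset ι) :
    derivative ℝ (bernoulliPoly p s : PowerSeries ℝ)
      = (C (∑ i ∈ s, p i) - C (∑ i ∈ s, p i ^ 2) * (X - 1) + C (∑ i ∈ s, p i ^ 3) * (X - 1) ^ 2)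
          * (bernoulliPoly p s : PowerSeries ℝ)
        - (X - 1) * ∑ i ∈ s, C (p i ^ 4)
          * ((X - 1) ^ 2 * (bernoulliPoly p (s.erase i) : PowerSeries ℝ)) := by
  rw [derivative_bernoulliPoly]
  simp only [map_sum, Finset.sum_mul, Finset.mul_sum, ← Finset.sum_sub_distrib,
    ← Finset.sum_add_distrib]
  refine Finset.sum_congr rfl fun i hi => ?_
  rw [bernoulliPoly_eq_mul_erase p hi]
  simp only [map_pow]
  ring

/-- The self-bounding estimate of the error: if the law with generating function `G` satisfies the
Stein identity of a Poisson–binomial convolution whose first moment matches that of the Bernoulli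
sum and whose next two factorial cumulants match up to the rounding defect `δ`, the total variation
distance `x` is controlled by the smoothness `b`, `c` of the Bernoulli sums and by a small multiple
of `x` itself. -/
theorem toReal_l1_bernoulliPoly_sub_le {ι : Type*} [DecidableEq ι] (p : ι → ℝ) (s : Finset ι)
    {G : PowerSeries ℝ} (hG : l1 G ≠ ∞) (hGsum : HasSum (fun j => coeff j G) 1)
    (hF : l1 (bernoulliPoly p s : PowerSeries ℝ) = 1)
    (hFsum : HasSum (fun j => coeff j (bernoulliPoly p s : PowerSeries ℝ)) 1)
    {a m r δ b c : ℝ} (hr0 : 0 ≤ r) (hr : r < 1 / 2) (hm : 0 ≤ m) (hδ : 0 ≤ δ)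
    (hb0 : 0 ≤ b) (hc0 : 0 ≤ c)
    (hstein : (1 + C r * (X - 1)) * derivative ℝ G
      = (C a * (1 + C r * (X - 1)) + C (m * r)) * G)
    (h1 : ∑ i ∈ s, p i = a + m * r) (h2 : ∑ i ∈ s, p i ^ 2 = (m + δ) * r ^ 2)
    (h3 : ∑ i ∈ s, p i ^ 3 = (m + δ) * r ^ 3) (hl : 0 < ∑ i ∈ s, p i)
    (hb : l1 ((X - 1) ^ 2 * (bernoulliPoly p s : PowerSeries ℝ)) ≤ ENNReal.ofReal b)
    (hc : ∀ i ∈ s, l1 ((X - 1) ^ 2 * (bernoulliPoly p (s.erase i) : PowerSeries ℝ))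
      ≤ ENNReal.ofReal c) :
    (l1 ((bernoulliPoly p s : PowerSeries ℝ) - G)).toReal
      ≤ 2 / (∑ i ∈ s, p i) * ((1 + 2 * r) * δ * r ^ 2 + (∑ i ∈ s, p i ^ 4) * c
        + m * r ^ 4 / (1 - 2 * r) * b
        + m * r ^ 2 / (1 - 2 * r) * (l1 ((bernoulliPoly p s : PowerSeries ℝ) - G)).toReal) := by
  have hr' : 0 < 1 - 2 * r := by linarith
  have hinv := mul_linearInv (show r < 1 by linarith)
  have hH := l1_linearInv_le hr0 hr
  have hexp := derivative_bernoulliPoly_expand p s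
  set H := linearInv r
  set F := (bernoulliPoly p s : PowerSeries ℝ) with hFdef
  set Q := ∑ i ∈ s, C (p i ^ 4)
    * ((X - 1) ^ 2 * (bernoulliPoly p (s.erase i) : PowerSeries ℝ)) with hQ
  set l := ∑ i ∈ s, p i with hldef
  have hD : l1 (F - G) ≠ ∞ :=
    ((l1_sub_le F G).trans_lt (ENNReal.add_lt_top.2 ⟨by rw [hF]; exact ENNReal.one_lt_top,
      hG.lt_top⟩)).ne
  set x := (l1 (F - G)).toReal with hx
  have hx0 : 0 ≤ x := ENNReal.toReal_nonneg
  have hDx : l1 (F - G) ≤ ENNReal.ofReal x := by rw [hx, ENNReal.ofReal_toReal hD]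
  set S := (C (δ * r ^ 3) * ((X - 1) * F) + C (δ * r ^ 2) * (-F)) + -Q
    + C (m * r ^ 4) * (H * ((X - 1) ^ 2 * F)) + C (m * r ^ 2) * (-(H * (F - G))) with hS
  have hG' : derivative ℝ G = C a * G + C (m * r) * (H * G) := by
    linear_combination H * hstein - (derivative ℝ G - C a * G) * hinv
  have heq : derivative ℝ (F - G) - C l * (F - G) = (X - 1) * S := by
    rw [map_sub, hexp, hG', h1, h2, h3, hS]
    simp only [map_mul, map_add, map_pow]
    linear_combination (-(C m * C r * G) + C m * C r ^ 2 * (X - 1) * F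
      - C m * C r ^ 3 * (X - 1) ^ 2 * F) * hinv
  have hQ0 : 0 ≤ ∑ i ∈ s, p i ^ 4 := Finset.sum_nonneg fun i _ => by positivity
  have hQle : l1 (-Q) ≤ ENNReal.ofReal ((∑ i ∈ s, p i ^ 4) * c) := by
    rw [l1_neg, hQ, Finset.sum_mul,
      ENNReal.ofReal_sum_of_nonneg fun i _ => mul_nonneg (by positivity) hc0]
    exact (l1_sum_le _ _).trans (Finset.sum_le_sum fun i hi =>
      l1_C_mul_le_ofReal (by positivity) (hc i hi))
  have hHmul : ∀ {K : PowerSeries ℝ} {u : ℝ}, l1 K ≤ ENNReal.ofReal u →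
      l1 (H * K) ≤ ENNReal.ofReal (1 / (1 - 2 * r) * u) := by
    intro K u hK
    rw [ENNReal.ofReal_mul (by positivity)]
    exact (l1_mul_le _ _).trans (mul_le_mul' hH hK)
  have hF1 : l1 (-F) ≤ ENNReal.ofReal 1 := by rw [l1_neg, hF, ENNReal.ofReal_one]
  have hF2 : l1 ((X - 1) * F) ≤ ENNReal.ofReal 2 := by
    refine (l1_X_sub_one_mul_le F).trans ?_
    rw [hF, mul_one]
    simp
  have hSle : l1 S ≤ ENNReal.ofReal (((δ * r ^ 3 * 2 + δ * r ^ 2 * 1) + (∑ i ∈ s, p i ^ 4) * c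
      + m * r ^ 4 * (1 / (1 - 2 * r) * b)) + m * r ^ 2 * (1 / (1 - 2 * r) * x)) := by
    refine l1_add_le_ofReal (by positivity) (by positivity) (l1_add_le_ofReal (by positivity)
      (by positivity) (l1_add_le_ofReal (by positivity) (by positivity) (l1_add_le_ofReal
        (by positivity) (by positivity) ?_ ?_) hQle) ?_) ?_
    · exact l1_C_mul_le_ofReal (by positivity) hF2
    · exact l1_C_mul_le_ofReal (by positivity) hF1
    · exact l1_C_mul_le_ofReal (by positivity) (hHmul hb)
    · refine l1_C_mul_le_ofReal (by positivity) ?_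
      rw [l1_neg]
      exact hHmul hDx
  have hDsum : HasSum (fun j => coeff j (F - G)) 0 := by
    have := hFsum.sub hGsum
    rw [sub_self] at this
    simpa using this
  have hmain := l1_le_of_derivative_sub_eq hl (hSle.trans_lt ENNReal.ofReal_lt_top).ne hDsum heq
  have hmain' := hmain.trans (mul_le_mul_right hSle _)
  rw [← ENNReal.ofReal_mul (by positivity)] at hmain'
  have hfin := ENNReal.toReal_le_of_le_ofReal (by positivity) hmain'
  refine hfin.trans (le_of_eq ?_)
  ring

end

section

open scoped ENNReal

/-! ### The parameters of the approximating law -/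

section Parameters

variable {n : ℕ} {p : Fin n → ℝ}

theorem sigmaSq_nonneg (hp : ∀ i, p i ∈ Set.Icc (0 : ℝ) 1) : 0 ≤ sigmaSq p :=
  Finset.sum_nonneg fun i _ => mul_nonneg (hp i).1 (sub_nonneg.2 (hp i).2)

theorem σ_sq (hp : ∀ i, p i ∈ Set.Icc (0 : ℝ) 1) : σ p ^ 2 = sigmaSq p :=
  Real.sq_sqrt (sigmaSq_nonneg hp)

theorem le_τ (p : Fin n → ℝ) (i : Fin n) : p i * (1 - p i) ≤ τ p :=
  le_ciSup (f := fun i => p i * (1 - p i)) (Set.finite_range _).bddAbove i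

theorem τ_nonneg (hp : ∀ i, p i ∈ Set.Icc (0 : ℝ) 1) : 0 ≤ τ p :=
  Real.iSup_nonneg fun i => mul_nonneg (hp i).1 (sub_nonneg.2 (hp i).2)

theorem τ_le_quarter (p : Fin n → ℝ) : τ p ≤ 1 / 4 :=
  Real.iSup_le (fun i => by nlinarith [sq_nonneg (p i - 1 / 2)]) (by norm_num)

theorem σ_mul_sqrt (hp : ∀ i, p i ∈ Set.Icc (0 : ℝ) 1) :
    σ p * √(σ p ^ 2 - τ p) = √(sigmaSq p * (sigmaSq p - τ p)) := by
  rw [σ_sq hp, σ, ← Real.sqrt_mul (sigmaSq_nonneg hp)]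

theorem realM_nonneg (hp : ∀ i, 0 ≤ p i) : 0 ≤ realM p := by
  have h2 : 0 ≤ ∑ i, p i ^ 2 := Finset.sum_nonneg fun i _ => pow_nonneg (hp i) 2
  unfold realM
  positivity

theorem δ_nonneg (hp : ∀ i, 0 ≤ p i) : 0 ≤ δ p :=
  sub_nonneg.2 (Nat.floor_le (realM_nonneg hp))

theorem δ_le_one (p : Fin n → ℝ) : δ p ≤ 1 := by
  have := Nat.lt_floor_add_one (realM p)
  unfold δ M
  linarith

theorem M_add_δ (p : Fin n → ℝ) : (M p : ℝ) + δ p = realM p := by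
  unfold δ; ring

theorem M_mul_prob_add_α (p : Fin n → ℝ) : M p * prob p + α p = lam p := by
  unfold α; ring

theorem realM_mul_prob_sq (h2 : 0 < ∑ i, p i ^ 2) (h3 : 0 < ∑ i, p i ^ 3) :
    realM p * prob p ^ 2 = ∑ i, p i ^ 2 := by
  unfold realM prob
  field_simp

theorem realM_mul_prob_cube (h2 : 0 < ∑ i, p i ^ 2) (h3 : 0 < ∑ i, p i ^ 3) :
    realM p * prob p ^ 3 = ∑ i, p i ^ 3 := by
  unfold realM prob
  field_simp

theorem θ₁_nonneg (hp : ∀ i, p i ∈ Set.Icc (0 : ℝ) 1) : 0 ≤ θ₁ p := by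
  rw [θ₁, M_mul_prob_add_α]
  have : 0 ≤ lam p := Finset.sum_nonneg fun i _ => (hp i).1
  positivity

/-- A Bernoulli sum with positive variance has positive power sums. -/
theorem exists_pos_of_sigmaSq_pos (hp : ∀ i, p i ∈ Set.Icc (0 : ℝ) 1) (h : 0 < sigmaSq p) :
    ∃ i, 0 < p i := by
  by_contra! hcon
  have : sigmaSq p = 0 := Finset.sum_eq_zero fun i _ => by
    rw [le_antisymm (hcon i) (hp i).1, zero_mul]
  linarith

theorem sum_pow_pos (hp : ∀ i, p i ∈ Set.Icc (0 : ℝ) 1) {i : Fin n} (hi : 0 < p i) (k : ℕ) :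
    0 < ∑ i, p i ^ k :=
  Finset.sum_pos' (fun j _ => pow_nonneg (hp j).1 k) ⟨i, Finset.mem_univ i, pow_pos hi k⟩

end Parameters

/-! ### Smoothness estimates and the error bound -/

section Bounds

variable {n : ℕ} {p : Fin n → ℝ}

theorem l1_sq_mul_bernoulliPoly_univ_le (hp : ∀ i, p i ∈ Set.Icc (0 : ℝ) 1)
    (h : 3 * τ p < σ p ^ 2) :
    l1 ((PowerSeries.X - 1) ^ 2 * (bernoulliPoly p Finset.univ : PowerSeries ℝ))
      ≤ ENNReal.ofReal (2 / (σ p * √(σ p ^ 2 - τ p))) := by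
  rw [σ_mul_sqrt hp]
  rw [σ_sq hp] at h
  have := τ_nonneg hp
  exact l1_X_sub_one_sq_mul_bernoulliPoly_le p Finset.univ (fun i _ => hp i) this
    (fun i _ => le_τ p i) (by change _ < sigmaSq p; linarith)

theorem l1_sq_mul_bernoulliPoly_erase_le (hp : ∀ i, p i ∈ Set.Icc (0 : ℝ) 1)
    (h : 3 * τ p < σ p ^ 2) (i : Fin n) :
    l1 ((PowerSeries.X - 1) ^ 2 * (bernoulliPoly p (Finset.univ.erase i) : PowerSeries ℝ))
      ≤ ENNReal.ofReal (2 / √((σ p ^ 2 - τ p) * (σ p ^ 2 - 3 * τ p))) := by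
  rw [σ_sq hp] at h ⊢
  have h0 := τ_nonneg hp
  have hi := le_τ p i
  have hV : ∑ j ∈ Finset.univ.erase i, p j * (1 - p j) = sigmaSq p - p i * (1 - p i) :=
    Finset.sum_erase_eq_sub (Finset.mem_univ i)
  refine (l1_X_sub_one_sq_mul_bernoulliPoly_le p (Finset.univ.erase i) (fun i _ => hp i) h0
    (fun i _ => le_τ p i) (by rw [hV]; linarith)).trans ?_
  rw [hV]
  refine ENNReal.ofReal_le_ofReal ?_
  have hpos : 0 < (sigmaSq p - τ p) * (sigmaSq p - 3 * τ p) :=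
    mul_pos (by linarith) (by linarith)
  have hpos' := Real.sqrt_pos.2 hpos
  refine div_le_div_of_nonneg_left (by norm_num) hpos' (Real.sqrt_le_sqrt ?_)
  exact mul_le_mul (by linarith) (by linarith) (by linarith) (by linarith)

variable {Ω : Type*} [MeasurableSpace Ω] {P : Measure Ω} [IsProbabilityMeasure P]
  {X : Fin n → Ω → ℕ}

theorem IsIndepBernoulli.pgf_lawSum (hX : IsIndepBernoulli P X p) :
    pgf (lawSum P X) = (bernoulliPoly p Finset.univ : PowerSeries ℝ) :=
  hX.pgf_map_sum Finset.univ

theorem IsIndepBernoulli.pgf_lawSumErase (hX : IsIndepBernoulli P X p) (i : Fin n) :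
    pgf (lawSumErase P X i) = (bernoulliPoly p (Finset.univ.erase i) : PowerSeries ℝ) :=
  hX.pgf_map_sum _

theorem IsIndepBernoulli.d_le (hX : IsIndepBernoulli P X p) (h : 3 * τ p < σ p ^ 2) :
    d P X ≤ 2 / (σ p * √(σ p ^ 2 - τ p)) := by
  rw [d, secondDiffNorm_eq, hX.pgf_lawSum]
  refine ENNReal.toReal_le_of_le_ofReal ?_ (l1_sq_mul_bernoulliPoly_univ_le hX.mem_Icc h)
  have : 0 ≤ σ p := Real.sqrt_nonneg _
  positivity

theorem IsIndepBernoulli.d₁_le (hX : IsIndepBernoulli P X p) (h : 3 * τ p < σ p ^ 2) :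
    d₁ P X ≤ 2 / √((σ p ^ 2 - τ p) * (σ p ^ 2 - 3 * τ p)) := by
  refine Real.iSup_le (fun i => ?_) (by positivity)
  rw [secondDiffNorm_eq, hX.pgf_lawSumErase]
  exact ENNReal.toReal_le_of_le_ofReal (by positivity)
    (l1_sq_mul_bernoulliPoly_erase_le hX.mem_Icc h i)

theorem IsIndepBernoulli.tvNorm_le (hX : IsIndepBernoulli P X p) (h : 3 * τ p < σ p ^ 2)
    (hmax : max (prob p) (θ₁ p) < 1 / 2) : tvNorm (lawSum P X) (bcp p) ≤ errorBound p := by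
  have hp := hX.mem_Icc
  have hp0 : ∀ i, 0 ≤ p i := fun i => (hp i).1
  obtain ⟨hr, hθ⟩ := max_lt_iff.1 hmax
  have hr0 := (prob_mem_Icc p hp).1
  have hτ := τ_nonneg hp
  have hσpos : 0 < sigmaSq p := by rw [σ_sq hp] at h; linarith
  obtain ⟨i₀, hi₀⟩ := exists_pos_of_sigmaSq_pos hp hσpos
  have hs2 := sum_pow_pos hp hi₀ 2
  have hs3 := sum_pow_pos hp hi₀ 3
  have hlam : 0 < lam p := by simpa [lam] using sum_pow_pos hp hi₀ 1
  have hδ := δ_nonneg hp0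
  have hσ0 : 0 ≤ σ p := Real.sqrt_nonneg _
  have hprobW : IsProbabilityMeasure (lawSum P X) :=
    Measure.isProbabilityMeasure_map
      (Finset.measurable_sum _ fun j _ => hX.measurable j).aemeasurable
  have hprobG : IsProbabilityMeasure (bcp p) := by
    unfold bcp poissonBinomial
    infer_instance
  have hα : (((α p).toNNReal : NNReal) : ℝ) = α p := Real.coe_toNNReal _ (α_nonneg p hp0)
  have hpr : ((Set.projIcc 0 1 zero_le_one (prob p) : unitInterval) : ℝ) = prob p := by
    rw [Set.projIcc_of_mem zero_le_one (prob_mem_Icc p hp)]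
  have hstein := derivative_pgf_poissonBinomial (α p).toNNReal (M p)
    (Set.projIcc 0 1 zero_le_one (prob p))
  rw [hα, hpr] at hstein
  have hFsum : HasSum (fun j => PowerSeries.coeff j
      (bernoulliPoly p Finset.univ : PowerSeries ℝ)) 1 := by
    rw [← hX.pgf_lawSum]
    simpa only [coeff_pgf] using hasSum_measureReal_singleton (lawSum P X)
  have hGsum : HasSum (fun j => PowerSeries.coeff j (pgf (bcp p))) 1 := by
    simpa only [coeff_pgf] using hasSum_measureReal_singleton (bcp p)
  set b := 2 / (σ p * √(σ p ^ 2 - τ p)) with hb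
  set c := 2 / √((σ p ^ 2 - τ p) * (σ p ^ 2 - 3 * τ p)) with hc
  have hb0 : 0 ≤ b := by positivity
  have hc0 : 0 ≤ c := by positivity
  have key := toReal_l1_bernoulliPoly_sub_le p Finset.univ (G := pgf (bcp p))
    (by rw [l1_pgf]; exact ENNReal.one_ne_top) hGsum (by rw [← hX.pgf_lawSum, l1_pgf]) hFsum
    hr0 hr (Nat.cast_nonneg (M p)) hδ hb0 hc0 hstein
    (by rw [add_comm, M_mul_prob_add_α, lam])
    (by rw [M_add_δ, realM_mul_prob_sq hs2 hs3]) (by rw [M_add_δ, realM_mul_prob_cube hs2 hs3])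
    hlam (l1_sq_mul_bernoulliPoly_univ_le hp h)
    (fun i _ => l1_sq_mul_bernoulliPoly_erase_le hp h i)
  rw [← hX.pgf_lawSum, ← tvNorm_eq] at key
  change _ ≤ 2 / lam p * _ at key
  set x := tvNorm (lawSum P X) (bcp p)
  have hx0 : 0 ≤ x := tsum_nonneg fun _ => abs_nonneg _
  have hr' : 0 < 1 - 2 * prob p := by linarith
  have hr1 : 1 - 2 * prob p ≤ 1 := by linarith
  have hsq : (1 - 2 * prob p) ^ 2 ≤ 1 - 2 * prob p := by nlinarith
  have hS4 : 0 ≤ ∑ i, p i ^ 4 := Finset.sum_nonneg fun i _ => pow_nonneg (hp0 i) 4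
  -- the Stein argument only needs one factor `1 - 2 p`; the stated bound has its square
  have hθle : M p * prob p ^ 2 / (1 - 2 * prob p) ≤ lam p * θ₁ p := by
    rw [θ₁, M_mul_prob_add_α]
    calc M p * prob p ^ 2 / (1 - 2 * prob p) ≤ M p * prob p ^ 2 / (1 - 2 * prob p) ^ 2 := by
          gcongr
      _ = _ := by field_simp
  have hM4 : M p * prob p ^ 4 / (1 - 2 * prob p) * b
      ≤ 2 * M p * prob p ^ 4 / ((1 - 2 * prob p) ^ 2 * σ p * √(σ p ^ 2 - τ p)) := by
    calc M p * prob p ^ 4 / (1 - 2 * prob p) * b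
        ≤ M p * prob p ^ 4 / (1 - 2 * prob p) ^ 2 * b := by gcongr
      _ = _ := by rw [hb, div_mul_div_comm]; ring_nf
  have hθ' : 0 < 1 - 2 * θ₁ p := by linarith
  have hc4 : (∑ i, p i ^ 4) * c
      = 2 * (∑ i, p i ^ 4) / √((σ p ^ 2 - τ p) * (σ p ^ 2 - 3 * τ p)) := by
    rw [hc]; ring
  unfold errorBound
  set A := 2 * (∑ i, p i ^ 4) / √((σ p ^ 2 - τ p) * (σ p ^ 2 - 3 * τ p))
  set B := 2 * M p * prob p ^ 4 / ((1 - 2 * prob p) ^ 2 * σ p * √(σ p ^ 2 - τ p))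
  have hkey2 : x ≤ 2 / lam p * ((1 + 2 * prob p) * δ p * prob p ^ 2 + A + B
      + lam p * θ₁ p * x) := by
    refine key.trans ?_
    rw [hc4]
    gcongr
  have hmul : lam p * x ≤ 2 * ((1 + 2 * prob p) * δ p * prob p ^ 2 + A + B
      + lam p * θ₁ p * x) := by
    rw [div_mul_eq_mul_div, le_div_iff₀ hlam] at hkey2
    linarith
  rw [div_mul_eq_mul_div, le_div_iff₀ (by positivity)]
  linarith

end Bounds

/-! ### The rate for success probabilities of constant order -/

/-- The condition `p ≤ ρ < 1 / 2` on the binomial success probability forces the variance to be of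
order `n`, even though single `p i` may be close to `1`. -/
theorem mul_le_sigmaSq {n : ℕ} {p : Fin n → ℝ} {a : ℝ} (ha : 0 < a)
    (hp : ∀ i, a ≤ p i ∧ p i ≤ 1) (hn : 0 < n) (hr : prob p ≤ 1 / 2) :
    n * a ^ 2 / 2 ≤ sigmaSq p := by
  have h2 : n * a ^ 2 ≤ ∑ i, p i ^ 2 := by
    have : ∑ _i : Fin n, a ^ 2 ≤ ∑ i, p i ^ 2 :=
      Finset.sum_le_sum fun i _ => pow_le_pow_left₀ ha.le (hp i).1 2
    simpa using this
  have hn' : (0 : ℝ) < n := by exact_mod_cast hn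
  have h2pos : 0 < ∑ i, p i ^ 2 := lt_of_lt_of_le (by positivity) h2
  have h3 : ∑ i, p i ^ 3 ≤ 1 / 2 * ∑ i, p i ^ 2 := by
    rwa [prob, div_le_iff₀ h2pos] at hr
  have h4 : ∑ i, p i ^ 2 - ∑ i, p i ^ 3 ≤ sigmaSq p := by
    rw [← Finset.sum_sub_distrib]
    refine Finset.sum_le_sum fun i _ => ?_
    have := ha.le.trans (hp i).1
    have := (hp i).2
    nlinarith [mul_nonneg (mul_nonneg ‹0 ≤ p i› (sub_nonneg.2 this)) (sub_nonneg.2 this)]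
  linarith

theorem errorBound_le {n : ℕ} {p : Fin n → ℝ} {a ρ : ℝ} (ha : 0 < a) (hρ : ρ < 1 / 2)
    (hp : ∀ i, a ≤ p i ∧ p i ≤ 1) (hn : 0 < n) (hna : 3 ≤ n * a ^ 2)
    (hmax : max (prob p) (θ₁ p) ≤ ρ) :
    3 * τ p < σ p ^ 2 ∧ errorBound p
      ≤ 2 / ((1 - 2 * ρ) * a) * (8 / a ^ 2 + 8 / ((1 - 2 * ρ) ^ 2 * a ^ 2) + 2) / n := by
  obtain ⟨hr, hθ⟩ := max_le_iff.1 hmax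
  have hn' : (0 : ℝ) < n := by exact_mod_cast hn
  have hpI : ∀ i, p i ∈ Set.Icc (0 : ℝ) 1 := fun i => ⟨ha.le.trans (hp i).1, (hp i).2⟩
  have hp0 : ∀ i, 0 ≤ p i := fun i => (hpI i).1
  have hi₀ : 0 < p ⟨0, hn⟩ := ha.trans_le (hp _).1
  have hs2 := sum_pow_pos hpI hi₀ 2
  have hs3 := sum_pow_pos hpI hi₀ 3
  have hσ := mul_le_sigmaSq ha hp hn (by linarith)
  have hτ := τ_le_quarter p
  have hτ0 := τ_nonneg hpI
  have hθ0 := θ₁_nonneg hpI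
  have hr0 := (prob_mem_Icc p hpI).1
  have hr1 := (prob_mem_Icc p hpI).2
  have hδ0 := δ_nonneg hp0
  have hδ1 := δ_le_one p
  have hρ' : 0 < 1 - 2 * ρ := by linarith
  set v := (n : ℝ) * a ^ 2 / 4 with hv
  have hv0 : 0 < v := by positivity
  have hv3 : v ≤ sigmaSq p - 3 * τ p := by linarith
  refine ⟨by rw [σ_sq hpI]; linarith, ?_⟩
  have hlam : n * a ≤ lam p := by
    have : ∑ _i : Fin n, a ≤ ∑ i, p i := Finset.sum_le_sum fun i _ => (hp i).1
    simpa [lam] using this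
  have hS4 : ∑ i, p i ^ 4 ≤ n := by
    have : ∑ i, p i ^ 4 ≤ ∑ _i : Fin n, (1 : ℝ) :=
      Finset.sum_le_sum fun i _ => pow_le_one₀ (hp0 i) (hp i).2
    simpa using this
  have hM4 : M p * prob p ^ 4 ≤ n := by
    have h1 : (M p : ℝ) ≤ realM p := Nat.floor_le (realM_nonneg hp0)
    have h2 : ∑ i, p i ^ 2 ≤ ∑ _i : Fin n, (1 : ℝ) :=
      Finset.sum_le_sum fun i _ => pow_le_one₀ (hp0 i) (hp i).2
    calc M p * prob p ^ 4 ≤ realM p * prob p ^ 2 := by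
          have := realM_nonneg hp0
          gcongr ?_ * ?_
          exact pow_le_pow_of_le_one hr0 hr1 (by norm_num)
      _ = ∑ i, p i ^ 2 := realM_mul_prob_sq hs2 hs3
      _ ≤ n := by simpa using h2
  have hsqrt1 : v ≤ √((σ p ^ 2 - τ p) * (σ p ^ 2 - 3 * τ p)) := by
    rw [σ_sq hpI]
    refine Real.le_sqrt_of_sq_le ?_
    nlinarith
  have hsqrt2 : v ≤ σ p * √(σ p ^ 2 - τ p) := by
    rw [σ_mul_sqrt hpI]
    refine Real.le_sqrt_of_sq_le ?_
    nlinarith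
  have hA : 2 * (∑ i, p i ^ 4) / √((σ p ^ 2 - τ p) * (σ p ^ 2 - 3 * τ p)) ≤ 8 / a ^ 2 := by
    calc _ ≤ 2 * (n : ℝ) / v := by gcongr
      _ = _ := by rw [hv]; field_simp; norm_num
  have hB : 2 * M p * prob p ^ 4 / ((1 - 2 * prob p) ^ 2 * σ p * √(σ p ^ 2 - τ p))
      ≤ 8 / ((1 - 2 * ρ) ^ 2 * a ^ 2) := by
    rw [mul_assoc 2, mul_assoc ((1 - 2 * prob p) ^ 2)]
    calc _ ≤ 2 * (n : ℝ) / ((1 - 2 * ρ) ^ 2 * v) := by gcongr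
      _ = _ := by rw [hv]; field_simp; norm_num
  have hC : (1 + 2 * prob p) * δ p * prob p ^ 2 ≤ 2 := by
    have h1 : (1 + 2 * prob p) ≤ 2 := by linarith
    have h2 : prob p ^ 2 ≤ 1 := pow_le_one₀ hr0 hr1
    calc (1 + 2 * prob p) * δ p * prob p ^ 2 ≤ 2 * 1 * 1 := by gcongr
      _ = 2 := by norm_num
  have hS40 : 0 ≤ ∑ i, p i ^ 4 := Finset.sum_nonneg fun i _ => pow_nonneg (hp0 i) 4
  have hσ0 : 0 ≤ σ p := Real.sqrt_nonneg _
  have hθ' : 1 - 2 * ρ ≤ 1 - 2 * θ₁ p := by linarith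
  have hθ'' : 0 ≤ 1 - 2 * θ₁ p := hρ'.le.trans hθ'
  unfold errorBound
  calc _ ≤ 2 / ((1 - 2 * ρ) * (n * a)) * (8 / a ^ 2 + 8 / ((1 - 2 * ρ) ^ 2 * a ^ 2) + 2) := by
        gcongr ?_ * ?_
        · gcongr
        · exact add_le_add (add_le_add hA hB) hC
    _ = _ := by field_simp

end

end BCP

theorem corollary4p2 :
    -- the smoothness estimates and the explicit error bound
    (∀ (Ω : Type*) [MeasurableSpace Ω] (P : Measure Ω) [IsProbabilityMeasure P]
        (n : ℕ) (p : Fin n → ℝ) (X : Fin n → Ω → ℕ),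
        BCP.IsIndepBernoulli P X p → 3 * BCP.τ p < BCP.σ p ^ 2 →
        BCP.d P X ≤ 2 / (BCP.σ p * √(BCP.σ p ^ 2 - BCP.τ p)) ∧
        BCP.d₁ P X ≤ 2 / √((BCP.σ p ^ 2 - BCP.τ p) * (BCP.σ p ^ 2 - 3 * BCP.τ p)) ∧
        (max (BCP.prob p) (BCP.θ₁ p) < 1 / 2 →
          BCP.tvNorm (BCP.lawSum P X) (BCP.bcp p) ≤ BCP.errorBound p)) ∧
    -- the rate for success probabilities of constant order
    (∀ a ρ : ℝ, 0 < a → ρ < 1 / 2 → ∃ (K : ℝ) (N : ℕ), ∀ n : ℕ, N ≤ n → ∀ p : Fin n → ℝ,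
        (∀ i, a ≤ p i ∧ p i ≤ 1) → max (BCP.prob p) (BCP.θ₁ p) ≤ ρ →
        3 * BCP.τ p < BCP.σ p ^ 2 ∧ BCP.errorBound p ≤ K / n ∧
        ∀ (Ω : Type*) [MeasurableSpace Ω] (P : Measure Ω) [IsProbabilityMeasure P]
          (X : Fin n → Ω → ℕ), BCP.IsIndepBernoulli P X p →
          BCP.tvNorm (BCP.lawSum P X) (BCP.bcp p) ≤ K / n) := by
  refine ⟨fun Ω _ P _ n p X hX h => ⟨hX.d_le h, hX.d₁_le h, hX.tvNorm_le h⟩, ?_⟩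
  intro a ρ ha hρ
  refine ⟨2 / ((1 - 2 * ρ) * a) * (8 / a ^ 2 + 8 / ((1 - 2 * ρ) ^ 2 * a ^ 2) + 2),
    ⌈3 / a ^ 2⌉₊ + 1, fun n hn p hp hmax => ?_⟩
  have hna : 3 ≤ n * a ^ 2 := by
    rw [← div_le_iff₀ (by positivity)]
    exact (Nat.le_ceil _).trans (by exact_mod_cast (Nat.le_succ _).trans hn)
  obtain ⟨h1, h2⟩ := BCP.errorBound_le ha hρ hp (by omega) hna hmax
  exact ⟨h1, h2, fun Ω _ P _ X hX => (hX.tvNorm_le h1 (hmax.trans_lt hρ)).trans h2⟩
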